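/- Let $\mathsf A$ be a finite alphabet with $|\mathsf A|\ge 2$ and let $(X_k)_{k\ge1}$ be the coordinate process on $\mathsf A^{\mathbb N}$; write $\mathbf P(x_{1:n})=\mathbf P(X_1=x_1,\dots,X_n=x_n)$. For $r\ge0$ let $\Theta^r$ be the set of laws $\mathbf P$ on $\mathsf A^{\mathbb N}$ of time-homogeneous Markov chains of order at most $r$: for some transition probabilities $q(\cdot\mid b)$, $b\in\mathsf A^r$, $$\mathbf P(x_{1:n})=\mathbf P(x_{1:r})\prod_{i=r+1}^n q(x_i\mid x_{i-r:i-1})\qquad\text{for all } n\ge r,\ x_{1:n}\in\mathsf A^n .$$ The order of $\mathbf P$ is the smallest $r$ with $\mathbf P\in\Theta^r$. Given a penalty $\mathrm{pen}(n,r)\in\mathbb R$ and a cutoff $\kappa(n)\in\mathbb R$, the penalized likelihood order estimator is $$\hat r_n=\hat r_n(x_{1:n})\in\operatorname*{argmax}_{0\le r<\kappa(n)}\Big\{\sup_{\mathbf P\in\Theta^r}\log\mathbf P(x_{1:n})-\mathrm{pen}(n,r)\Big\},$$ with ties broken arbitrarily (and with an arbitrary value when $\kappa(n)\le0$). There is an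 absolute constant $C^\star>0$, and for every finite alphabet $\mathsf A$ with $|\mathsf A|\ge2$ and every stationary Markov chain $\mathbf P^\star$ on $\mathsf A$ of order $r^\star<\infty$ that is irreducible (for any words $u,v\in\mathsf A^{r^\star}$ of positive probability there is $m\ge0$ with $\mathbf P^\star(X_{1:r^\star}=u,\,X_{m+1:m+r^\star}=v)>0$) there is a constant $\alpha^\star>0$, depending on $\mathbf P^\star$, with the following property. Let $\mathrm{pen}$, $\kappa$ and $f:\mathbb N\to\mathbb R$ be such that for all sufficiently large $n$ $$\mathrm{pen}(n,r)=|\mathsf A|^r f(n)\log\log n\quad(r\ge0),\qquad \kappa(n)\le\alpha^\star\log n,$$ where $\kappa$ is nondecreasing with $\kappa(n)\to\infty$, and $$\liminf_{n\to\infty}f(n)\ge C^\star,\qquad \lim_{n\to\infty}\frac{f(n)\log\log n}{n}=0 .$$ Then the estimator is strongly consistent: $\hat r_n(X_{1:n})\to r^\star$ as $n\to\infty$, $\mathbf P^\star$-almost surely. -/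

import Mathlib

open MeasureTheory Filter Topology

noncomputable section

namespace MarkovOrder

variable {A : Type*}

/-- The word `x_{m+1:m+n}` of a sequence `x`; the coordinate `X_k` (`k ≥ 1`) of the canonical space
is `ω ↦ ω (k - 1)`, so the index set `{1, 2, …}` is shifted to `{0, 1, …}`. -/
def block (x : ℕ → A) (m n : ℕ) : Fin n → A := fun i => x (m + i)

/-- `P(x_{1:n})`, the probability that the first `n` letters form the word `x`. -/
def wordProb [MeasurableSpace A] (P : Measure (ℕ → A)) {n : ℕ} (x : Fin n → A) : ENNReal :=
  P {ω | block ω 0 n = x}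

/-- The set `Θ^r` of laws of time homogeneous Markov chains of order at most `r`, with arbitrary
initial law on `A^r`: for some transition probabilities `q(· | b)`, `b ∈ A^r`,
`P(x_{1:n}) = P(x_{1:r}) ∏_{i=r+1}^{n} q(x_i | x_{i-r:i-1})` for all `n = r + m ≥ r`.
(Then `P(X_i = a | X_{i-r:i-1} = b) = q(a | b)` for all `i > r` for which the conditioning
event has positive probability; the other values of `q` are irrelevant.) -/
def markovLaws (A : Type*) [MeasurableSpace A] (r : ℕ) : Set (Measure (ℕ → A)) :=
  {P | IsProbabilityMeasure P ∧ ∃ q : (Fin r → A) → PMF A, ∀ (m : ℕ) (x : ℕ → A),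
    wordProb P (block x 0 (r + m)) =
      wordProb P (block x 0 r) * ∏ j ∈ Finset.range m, q (block x j r) (x (j + r))}

/-- `P` is the law of a Markov chain of order exactly `r`. -/
def HasOrder [MeasurableSpace A] (P : Measure (ℕ → A)) (r : ℕ) : Prop :=
  IsLeast {k | P ∈ markovLaws A k} r

/-- Stationarity: the law is invariant under the left shift. -/
def IsStationary [MeasurableSpace A] (P : Measure (ℕ → A)) : Prop :=
  MeasurePreserving (fun (ω : ℕ → A) (k : ℕ) => ω (k + 1)) P P

/-- Irreducibility of a (stationary) chain of order `r`: any two words of length `r` of positive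
probability (the states of the chain of `r`-blocks) communicate. -/
def IsIrreducible [MeasurableSpace A] (P : Measure (ℕ → A)) (r : ℕ) : Prop :=
  ∀ u v : Fin r → A, 0 < wordProb P u → 0 < wordProb P v →
    ∃ m : ℕ, 0 < P {ω | block ω 0 r = u ∧ block ω m r = v}

/-- The maximal log-likelihood `sup_{P ∈ Θ^r} log P(x_{1:n})`, where `log 0 = -∞`. -/
def maxLogLik [MeasurableSpace A] (r : ℕ) {n : ℕ} (x : Fin n → A) : EReal :=
  ⨆ P ∈ markovLaws A r, ENNReal.log (wordProb P x)

/-- `rhat` is a penalized likelihood order estimator with penalty `pen` and cutoff `κ`: at every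
`x_{1:n}` it picks a maximizer of the penalized likelihood over `0 ≤ r < κ(n)`, with ties broken
arbitrarily (and any value if there is no such `r`, i.e. if `κ(n) ≤ 0`). -/
def IsPenalizedLikelihoodEstimator [MeasurableSpace A] (pen : ℕ → ℕ → ℝ) (κ : ℕ → ℝ)
    (rhat : (n : ℕ) → (Fin n → A) → ℕ) : Prop :=
  ∀ (n : ℕ) (x : Fin n → A), 0 < κ n →
    (rhat n x : ℝ) < κ n ∧
      IsMaxOn (fun r : ℕ => maxLogLik r x - (pen n r : EReal)) {r : ℕ | (r : ℝ) < κ n} (rhat n x)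

/-- Almost sure convergence of the estimator, under `P`, to `r`. -/
def IsStronglyConsistent [MeasurableSpace A] (P : Measure (ℕ → A)) (r : ℕ)
    (rhat : (n : ℕ) → (Fin n → A) → ℕ) : Prop :=
  ∀ᵐ ω ∂P, Tendsto (fun n : ℕ => rhat n (block ω 0 n)) atTop (𝓝 r)

end MarkovOrder

end

/-!
An order above the true order `r` is refuted as follows. For each context, mix the likelihood ratios
of Pólya urns of initial masses `2 ^ k` against the true transition probabilities. The product of
these mixtures over all contexts of a given length is a nonnegative supermartingale, so Ville's
inequality bounds it uniformly in time, and also in the order at the price of a factor `2 ^ k`.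
Since the nonzero transition probabilities are bounded away from `0`, the urn whose initial mass is
comparable to the number of visits to a context attains a fixed power of the maximal likelihood
ratio there, up to a constant; the mixture loses only `O(log log n)` more. Hence an order `k > r`
gains at most `O(k) + 16 * |A| ^ k * (log log n + O(1))` in log-likelihood, which is less than the
extra penalty.

An order below `r` is refuted by Hellinger affinities. By irreducibility there is a number of steps
over which every chain of the smaller order has affinity `< 1` with the true chain, from every
state. By compactness finitely many upper brackets with the same property cover all these chains,
and for each bracket a Lyapunov function shows that the root of the likelihood ratio decays
exponentially. So a smaller order loses a multiple of `n`, which exceeds the penalty.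
-/

noncomputable section

namespace MarkovOrder

/-! ### Almost sure bounds -/

section AlmostSure

variable {Ω : Type*} {m0 : MeasurableSpace Ω} {μ : Measure Ω}

/-- **Ville's inequality**, for processes that need only be supermartingales in the sense that
their integrals over the events of the past decrease. -/
theorem mul_measure_exists_le_lintegral {ℱ : Filtration ℕ m0} {Y : ℕ → Ω → ENNReal}
    (hY : ∀ m, Measurable[ℱ m] (Y m))
    (hdecr : ∀ m E, MeasurableSet[ℱ m] E → ∫⁻ ω in E, Y (m + 1) ω ∂μ ≤ ∫⁻ ω in E, Y m ω ∂μ)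
    (t : ENNReal) :
    t * μ {ω | ∃ m, t ≤ Y m ω} ≤ ∫⁻ ω, Y 0 ω ∂μ := by
  let hit : ℕ → Set Ω := fun n => {ω | ∃ m < n, t ≤ Y m ω}
  have hit_succ (n) : hit (n + 1) = hit n ∪ {ω | t ≤ Y n ω} := by
    ext ω
    simp only [hit, Set.mem_ofPred_eq, Set.mem_union, Nat.exists_lt_succ_right]
  have measurable_hit (n) : MeasurableSet[ℱ n] (hit (n + 1)) := by
    have : hit (n + 1) = ⋃ m ∈ Set.Iio (n + 1), {ω | t ≤ Y m ω} := by ext; simp [hit]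
    rw [this]
    exact MeasurableSet.biUnion (Set.to_countable _) fun m hm =>
      ((hY m).mono (ℱ.mono (Nat.lt_succ_iff.1 hm)) le_rfl) measurableSet_Ici
  have key (n) : t * μ (hit n) + ∫⁻ ω in (hit n)ᶜ, Y n ω ∂μ ≤ ∫⁻ ω, Y 0 ω ∂μ := by
    induction n with
    | zero => simp [hit]
    | succ n ih =>
      have hge : MeasurableSet {ω | t ≤ Y n ω} := ℱ.le n _ (hY n measurableSet_Ici)
      have hnew : μ (hit (n + 1)) ≤ μ (hit n) + μ ((hit n)ᶜ ∩ {ω | t ≤ Y n ω}) := by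
        rw [hit_succ, ← Set.union_sdiff_self, Set.sdiff_eq, Set.inter_comm]
        exact measure_union_le _ _
      have hmarkov : t * μ ((hit n)ᶜ ∩ {ω | t ≤ Y n ω}) ≤
          ∫⁻ ω in (hit n)ᶜ ∩ {ω | t ≤ Y n ω}, Y n ω ∂μ := by
        rw [← setLIntegral_const]
        exact setLIntegral_mono ((hY n).mono (ℱ.le n) le_rfl) fun ω hω => hω.2
      calc t * μ (hit (n + 1)) + ∫⁻ ω in (hit (n + 1))ᶜ, Y (n + 1) ω ∂μ
          ≤ t * (μ (hit n) + μ ((hit n)ᶜ ∩ {ω | t ≤ Y n ω}))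
            + ∫⁻ ω in (hit (n + 1))ᶜ, Y n ω ∂μ :=
            add_le_add (by gcongr) (hdecr n _ (measurable_hit n).compl)
        _ ≤ t * μ (hit n) + (∫⁻ ω in (hit n)ᶜ ∩ {ω | t ≤ Y n ω}, Y n ω ∂μ
            + ∫⁻ ω in (hit n)ᶜ \ {ω | t ≤ Y n ω}, Y n ω ∂μ) := by
            rw [mul_add, add_assoc, hit_succ, Set.compl_union, ← Set.sdiff_eq]
            gcongr
        _ ≤ ∫⁻ ω, Y 0 ω ∂μ := by rwa [lintegral_inter_add_sdiff _ _ hge]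
  have hmono : Monotone hit := fun _ _ h _ ⟨m, hm, hle⟩ => ⟨m, hm.trans_le h, hle⟩
  have hunion : {ω | ∃ m, t ≤ Y m ω} = ⋃ n, hit n := by
    ext ω
    simp only [Set.mem_ofPred_eq, Set.mem_iUnion, hit]
    exact ⟨fun ⟨m, hm⟩ => ⟨m + 1, m, m.lt_succ_self, hm⟩, fun ⟨_, m, _, hm⟩ => ⟨m, hm⟩⟩
  rw [hunion, hmono.measure_iUnion, ENNReal.mul_iSup]
  exact iSup_le fun n => le_self_add.trans (key n)

/-- The bound is uniform in `d` because the tails of the weights `2 ^ d` are summable. -/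
theorem ae_exists_forall_le_mul_two_pow {X : ℕ → Ω → ENNReal}
    (hX : ∀ d t, t * μ {ω | t < X d ω} ≤ 1) :
    ∀ᵐ ω ∂μ, ∃ K : ℕ, ∀ d, X d ω ≤ K * 2 ^ d := by
  rw [ae_iff]
  set S : Set Ω := {ω | ¬∃ K : ℕ, ∀ d, X d ω ≤ K * 2 ^ d}
  have hK (K : ℕ) : K * μ S ≤ 2 := by
    have hsub : S ⊆ ⋃ d, {ω | K * 2 ^ d < X d ω} := by
      intro ω hω
      simpa using fun h => hω ⟨K, h⟩
    have hd (d : ℕ) : K * μ {ω | K * 2 ^ d < X d ω} ≤ 2⁻¹ ^ d := by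
      have h := hX d (K * 2 ^ d)
      rw [← ENNReal.inv_pow, ← one_div, ENNReal.le_div_iff_mul_le (by simp) (by simp)]
      calc _ = K * 2 ^ d * μ {ω | K * 2 ^ d < X d ω} := by ring
        _ ≤ 1 := h
    calc (K : ENNReal) * μ S ≤ K * ∑' d, μ {ω | K * 2 ^ d < X d ω} := by
          gcongr
          exact (measure_mono hsub).trans (measure_iUnion_le _)
      _ ≤ ∑' d : ℕ, 2⁻¹ ^ d := by
          rw [← ENNReal.tsum_mul_left]
          exact ENNReal.tsum_le_tsum hd
      _ = 2 := by rw [ENNReal.tsum_geometric, ENNReal.one_sub_inv_two, inv_inv]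
  by_contra h0
  obtain ⟨K, hlt⟩ := ENNReal.exists_nat_mul_gt h0 (ENNReal.ofNat_ne_top (n := 2))
  exact hlt.not_ge (hK K)

theorem ae_eventually_le_pow_of_lintegral_le {Y : ℕ → Ω → ENNReal} {l b c : ENNReal}
    (hb : b ≠ ⊤) (hlb : l < b) (hc : c ≠ ⊤) (hY : ∀ m, Measurable (Y m))
    (hle : ∀ m, ∫⁻ ω, Y m ω ∂μ ≤ l ^ m * c) :
    ∀ᵐ ω ∂μ, ∀ᶠ m in atTop, Y m ω ≤ b ^ m := by
  have hb0 : b ≠ 0 := hlb.ne_bot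
  have hmarkov (m : ℕ) : μ {ω | b ^ m ≤ Y m ω} ≤ (l / b) ^ m * c := by
    calc μ {ω | b ^ m ≤ Y m ω} ≤ (∫⁻ ω, Y m ω ∂μ) / b ^ m :=
          meas_ge_le_lintegral_div (hY m).aemeasurable (pow_ne_zero m hb0)
            (ENNReal.pow_ne_top hb)
      _ ≤ l ^ m * c / b ^ m := by gcongr; exact hle m
      _ = (l / b) ^ m * c := by
          rw [div_eq_mul_inv, div_eq_mul_inv, mul_pow, ENNReal.inv_pow]; ring
  have hsum : ∑' m, μ {ω | b ^ m ≤ Y m ω} ≠ ⊤ := by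
    refine ne_top_of_le_ne_top ?_ (ENNReal.tsum_le_tsum hmarkov)
    rw [ENNReal.tsum_mul_right, ENNReal.tsum_geometric]
    have hlt : l / b < 1 := ENNReal.div_lt_of_lt_mul (by simpa using hlb)
    exact ENNReal.mul_ne_top (ENNReal.inv_ne_top.2 (tsub_pos_of_lt hlt).ne') hc
  filter_upwards [ae_eventually_notMem hsum] with ω hω
  filter_upwards [hω] with m hm
  exact (not_le.1 hm).le

theorem ae_measure_preimage_singleton_ne_zero {ι : Type*} [Countable ι] (μ : Measure Ω)
    (X : Ω → ι) : ∀ᵐ ω ∂μ, μ {ω' | X ω' = X ω} ≠ 0 := by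
  have h : ∀ᵐ ω ∂μ, ∀ i, μ {ω' | X ω' = i} = 0 → X ω ≠ i := by
    refine ae_all_iff.2 fun i => eventually_imp_distrib_left.2 fun hi => ?_
    simpa [ae_iff] using hi
  filter_upwards [h] with ω hω h0 using hω _ h0 rfl

end AlmostSure

/-! ### Words -/

section Words

variable {A : Type*}

theorem block_congr {x y : ℕ → A} {m n : ℕ} (h : ∀ i < m + n, x i = y i) :
    block x m n = block y m n :=
  funext fun i => h _ (by omega)

theorem block_update {x : ℕ → A} {m n k : ℕ} (h : m + n ≤ k) (a : A) :
    block (Function.update x k a) m n = block x m n :=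
  block_congr fun i hi => Function.update_of_ne (by omega) _ _

theorem block_zero_eq_iff {x y : ℕ → A} {n : ℕ} :
    block x 0 n = block y 0 n ↔ ∀ i < n, x i = y i := by
  refine ⟨fun h i hi => ?_, fun h => block_congr fun i hi => h i (by omega)⟩
  simpa [block] using congrFun h ⟨i, hi⟩

theorem block_zero_succ (x : ℕ → A) (n : ℕ) :
    block x 0 (n + 1) = Fin.snoc (block x 0 n) (x n) := by
  funext i
  induction i using Fin.lastCases <;> simp [block]

theorem block_zero_succ_eq_iff {x y : ℕ → A} {n : ℕ} :
    block x 0 (n + 1) = block y 0 (n + 1) ↔ block x 0 n = block y 0 n ∧ x n = y n := by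
  simp only [block_zero_eq_iff, Nat.lt_succ_iff_lt_or_eq, or_imp, forall_and, forall_eq]

theorem block_surjective [Nonempty A] (n : ℕ) :
    Function.Surjective fun x : ℕ → A => block x 0 n := fun w =>
  ⟨Function.extend Fin.val w fun _ => Classical.arbitrary A, funext fun i => by
    simp [block, Fin.val_injective.extend_apply]⟩

variable [MeasurableSpace A]

theorem measurable_block (m n : ℕ) : Measurable fun ω : ℕ → A => block ω m n :=
  measurable_pi_lambda _ fun _ => measurable_pi_apply _

/-- The filtration generated by the prefixes, with `n` letters known at time `n`;
`Filtration.piLE` reveals the letter number `n` already at time `n`. -/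
def blockFiltration (A : Type*) [MeasurableSpace A] :
    Filtration ℕ (MeasurableSpace.pi : MeasurableSpace (ℕ → A)) where
  seq n := MeasurableSpace.comap (fun ω => block ω 0 n) inferInstance
  mono' m n hmn := by
    have : (fun ω : ℕ → A => block ω 0 m) =
        (fun x : Fin n → A => x ∘ Fin.castLE hmn) ∘ fun ω => block ω 0 n := rfl
    beta_reduce
    rw [this, ← MeasurableSpace.comap_comp]
    exact MeasurableSpace.comap_mono (Measurable.comap_le (by fun_prop))
  le' n := (measurable_block 0 n).comap_le

theorem measurable_blockFiltration [Finite A] [MeasurableSingletonClass A] {β : Type*}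
    [Nonempty β] [MeasurableSpace β] {n : ℕ} {F : (ℕ → A) → β}
    (hF : F.FactorsThrough fun ω => block ω 0 n) : Measurable[blockFiltration A n] F := by
  obtain ⟨f, rfl⟩ := (Function.factorsThrough_iff F).1 hF
  exact (measurable_of_countable f).comp (comap_measurable _)

theorem measurable_of_factorsThrough_block [Finite A] [MeasurableSingletonClass A] {β : Type*}
    [Nonempty β] [MeasurableSpace β] {n : ℕ} {F : (ℕ → A) → β}
    (hF : F.FactorsThrough fun ω => block ω 0 n) : Measurable F :=
  (measurable_blockFiltration hF).mono ((blockFiltration A).le n) le_rfl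

theorem mem_iff_of_measurableSet_blockFiltration {n : ℕ} {E : Set (ℕ → A)}
    (hE : MeasurableSet[blockFiltration A n] E) {x y : ℕ → A} (h : block x 0 n = block y 0 n) :
    x ∈ E ↔ y ∈ E := by
  obtain ⟨S, -, rfl⟩ := hE
  simp only [Set.mem_preimage, h]

theorem lintegral_comp_block [Fintype A] [MeasurableSingletonClass A] (P : Measure (ℕ → A))
    {n : ℕ} (f : (Fin n → A) → ENNReal) :
    ∫⁻ ω, f (block ω 0 n) ∂P = ∑ x, f x * wordProb P x := by
  classical
  rw [← lintegral_map (μ := P) (measurable_of_countable f) (measurable_block 0 n),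
    lintegral_fintype]
  refine Finset.sum_congr rfl fun x _ => ?_
  rw [Measure.map_apply (measurable_block 0 n) (measurableSet_singleton x)]
  rfl

theorem ae_wordProb_pos [Finite A] (P : Measure (ℕ → A)) :
    ∀ᵐ ω ∂P, ∀ n, 0 < wordProb P (block ω 0 n) :=
  ae_all_iff.2 fun n => (ae_measure_preimage_singleton_ne_zero P fun ω => block ω 0 n).mono
    fun _ => pos_iff_ne_zero.2

theorem wordProb_block_anti (P : Measure (ℕ → A)) (x : ℕ → A) :
    Antitone fun n => wordProb P (block x 0 n) := fun _ _ hmn =>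
  measure_mono fun _ hω => block_zero_eq_iff.2 fun i hi =>
    block_zero_eq_iff.1 hω i (hi.trans_le hmn)

end Words

/-! ### Transition probabilities -/

section Transition

variable {A : Type*} [MeasurableSpace A] {P : Measure (ℕ → A)} {r : ℕ} {q : (Fin r → A) → PMF A}

/-- `q` is a family of transition probabilities of order `r` for `P`: the condition that defines
`markovLaws`, with the family named. -/
def IsTransition (P : Measure (ℕ → A)) (r : ℕ) (q : (Fin r → A) → PMF A) : Prop :=
  ∀ (m : ℕ) (x : ℕ → A),
    wordProb P (block x 0 (r + m)) =
      wordProb P (block x 0 r) * ∏ j ∈ Finset.range m, q (block x j r) (x (j + r))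

theorem mem_markovLaws_iff :
    P ∈ markovLaws A r ↔ IsProbabilityMeasure P ∧ ∃ q, IsTransition P r q :=
  Iff.rfl

theorem IsTransition.wordProb_succ (hq : IsTransition P r q) (m : ℕ) (x : ℕ → A) :
    wordProb P (block x 0 (m + r + 1)) =
      wordProb P (block x 0 (m + r)) * q (block x m r) (x (m + r)) := by
  have h := hq (m + 1) x
  rw [Finset.prod_range_succ, ← mul_assoc, ← hq m x] at h
  rw [show m + r + 1 = r + (m + 1) by omega, h, show m + r = r + m by omega]

theorem IsTransition.pos_of_wordProb_pos (hq : IsTransition P r q) {x : ℕ → A}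
    (hx : ∀ n, 0 < wordProb P (block x 0 n)) (m : ℕ) : 0 < q (block x m r) (x (m + r)) := by
  have h := hx (m + r + 1)
  rw [hq.wordProb_succ] at h
  exact pos_iff_ne_zero.2 (right_ne_zero_of_mul h.ne')

theorem IsTransition.lintegral_eq [Fintype A] [MeasurableSingletonClass A]
    (hq : IsTransition P r q) {m : ℕ} {F : (ℕ → A) → ENNReal}
    (hF : F.FactorsThrough fun ω => block ω 0 (m + r + 1)) :
    ∫⁻ ω, F ω ∂P =
      ∫⁻ ω, ∑ a, q (block ω m r) a * F (Function.update ω (m + r) a) ∂P := by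
  obtain ⟨f, rfl⟩ := (Function.factorsThrough_iff F).1 hF
  have hsuffix (ω : ℕ → A) : block ω m r = block ω 0 (m + r) ∘ Fin.natAdd m := by
    funext i
    simp [block]
  have hsnoc (x : Fin (m + r) → A) (a : A) : wordProb P (Fin.snoc x a : Fin (m + r + 1) → A) =
      wordProb P x * q (x ∘ Fin.natAdd m) a := by
    have : Nonempty A := ⟨a⟩
    obtain ⟨ω, rfl⟩ := block_surjective (m + r) x
    have h := hq.wordProb_succ m (Function.update ω (m + r) a)
    rwa [block_zero_succ, Function.update_self, block_update (by simp), block_update le_rfl,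
      hsuffix] at h
  have hupdate (ω : ℕ → A) (a : A) : block (Function.update ω (m + r) a) 0 (m + r + 1) =
      Fin.snoc (block ω 0 (m + r)) a := by
    rw [block_zero_succ, Function.update_self, block_update (by simp)]
  simp only [Function.comp_apply, hupdate, hsuffix]
  rw [lintegral_comp_block, lintegral_comp_block P fun x : Fin (m + r) → A =>
      ∑ a, q (x ∘ Fin.natAdd m) a * f (Fin.snoc x a),
    ← (Fin.snocEquiv fun _ => A).sum_comp, Fintype.sum_prod_type_right]
  refine Finset.sum_congr rfl fun x _ => ?_
  rw [Finset.sum_mul]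
  refine Finset.sum_congr rfl fun a _ => ?_
  rw [show Fin.snocEquiv (fun _ => A) (a, x) = Fin.snoc x a from rfl, hsnoc]
  ring

theorem IsTransition.measure_inter_eq_lintegral [Finite A] [MeasurableSingletonClass A]
    (hq : IsTransition P r q) {m : ℕ} {E : Set (ℕ → A)}
    (hE : MeasurableSet[blockFiltration A (m + r)] E) (a : A) :
    P (E ∩ {ω | ω (m + r) = a}) = ∫⁻ ω in E, q (block ω m r) a ∂P := by
  classical
  have := Fintype.ofFinite A
  have hE' : MeasurableSet E := (blockFiltration A).le _ _ hE
  have hlet : MeasurableSet {ω : ℕ → A | ω (m + r) = a} :=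
    (measurableSet_singleton a).preimage (measurable_pi_apply (m + r))
  have hF : ((E ∩ {ω | ω (m + r) = a}).indicator 1 : (ℕ → A) → ENNReal).FactorsThrough
      fun ω => block ω 0 (m + r + 1) := by
    intro x y hxy
    obtain ⟨hpre, hlast⟩ := block_zero_succ_eq_iff.1 hxy
    simp only [Set.indicator_apply, Set.mem_inter_iff,
      mem_iff_of_measurableSet_blockFiltration hE hpre, Set.mem_ofPred_eq, hlast, Pi.one_apply]
  rw [← lintegral_indicator_one (hE'.inter hlet), hq.lintegral_eq hF, ← lintegral_indicator hE']
  refine lintegral_congr fun ω => ?_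
  have hmem (b : A) : Function.update ω (m + r) b ∈ E ↔ ω ∈ E :=
    mem_iff_of_measurableSet_blockFiltration hE (block_update (by simp) b)
  simp [Set.indicator_apply, hmem, ite_and]

end Transition

/-! ### The function `x log x + 1 - x` -/

section KlFun

open InformationTheory

theorem mul_klFun_div {c : ℝ} (hc : c ≠ 0) (x : ℝ) :
    c * klFun (x / c) = x * Real.log (x / c) + c - x := by
  rw [klFun]
  field_simp

theorem log_le_klFun_add_one_sub {y : ℝ} (hy : 0 < y) :
    Real.log y ≤ klFun (y + 1) - klFun y := by
  have h := Real.one_sub_inv_le_log_of_pos (x := (y + 1) / y) (by positivity)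
  rw [Real.log_div (by positivity) hy.ne', inv_div] at h
  have h' := mul_le_mul_of_nonneg_left h (by positivity : 0 ≤ y + 1)
  rw [mul_sub, mul_div_cancel₀ _ (by positivity)] at h'
  simp only [klFun]
  linarith

theorem klFun_add_one_sub_le_log {y : ℝ} (hy : 0 < y) :
    klFun (y + 1) - klFun y ≤ Real.log (y + 1) := by
  have h := Real.log_le_sub_one_of_pos (x := (y + 1) / y) (by positivity)
  rw [Real.log_div (by positivity) hy.ne'] at h
  have h' := mul_le_mul_of_nonneg_left h hy.le
  rw [mul_sub y ((y + 1) / y), mul_div_cancel₀ _ hy.ne'] at h'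
  simp only [klFun]
  linarith

theorem sum_log_add_le_klFun_sub {s : ℝ} (hs : 0 < s) (T : ℕ) :
    ∑ i ∈ Finset.range T, Real.log (s + i) ≤ klFun (s + T) - klFun s := by
  induction T with
  | zero => simp
  | succ T ih =>
    have h := log_le_klFun_add_one_sub (y := s + T) (by positivity)
    rw [Finset.sum_range_succ, Nat.cast_succ, ← add_assoc]
    linarith

theorem klFun_sub_sub_le_sum_log_add {s : ℝ} (hs : 0 < s) (T : ℕ) :
    klFun (s + T) - klFun s - (Real.log (s + T) - Real.log s) ≤
      ∑ i ∈ Finset.range T, Real.log (s + i) := by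
  induction T with
  | zero => simp
  | succ T ih =>
    have h := klFun_add_one_sub_le_log (y := s + T) (by positivity)
    rw [Finset.sum_range_succ, Nat.cast_succ, ← add_assoc]
    linarith

theorem klFun_le_sq {x : ℝ} (hx : 0 ≤ x) : klFun x ≤ (x - 1) ^ 2 := by
  rcases hx.eq_or_lt with rfl | hx
  · simp [klFun]
  · calc klFun x = x * Real.log x + 1 - x := rfl
      _ ≤ x * (x - 1) + 1 - x := by gcongr; exact Real.log_le_sub_one_of_pos hx
      _ = (x - 1) ^ 2 := by ring

theorem sq_half_le_klFun {v : ℝ} (hv : -1 ≤ v) (hv' : v ≤ 0) : v ^ 2 / 2 ≤ klFun (1 + v) := by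
  have hd (x : ℝ) (hx : x ∈ interior (Set.Icc (-1 : ℝ) 0)) :
      HasDerivAt (fun v : ℝ => klFun (1 + v) - v ^ 2 / 2) (Real.log (1 + x) - x) x := by
    rw [interior_Icc] at hx
    have hkl : HasDerivAt (fun v : ℝ => klFun (1 + v)) (Real.log (1 + x)) x :=
      (hasDerivAt_klFun (x := 1 + x) (by linarith [hx.1])).comp_const_add 1 x
    exact hkl.sub (by simpa using (hasDerivAt_pow 2 x).div_const 2)
  have hanti : AntitoneOn (fun v : ℝ => klFun (1 + v) - v ^ 2 / 2) (Set.Icc (-1) 0) := by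
    refine antitoneOn_of_deriv_nonpos (convex_Icc _ _) (Continuous.continuousOn (by fun_prop))
      (fun x hx => (hd x hx).differentiableAt.differentiableWithinAt) fun x hx => ?_
    rw [(hd x hx).deriv]
    rw [interior_Icc] at hx
    linarith [Real.log_le_sub_one_of_pos (show 0 < 1 + x by linarith [hx.1])]
  have h := hanti ⟨hv, hv'⟩ ⟨by norm_num, le_rfl⟩ hv'
  simp only [add_zero, klFun_one] at h
  linarith

theorem klFun_le_mul_klFun_of_nonneg {β u : ℝ} (hβ : 1 / 2 ≤ β) (hu : 0 ≤ u) :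
    klFun (1 + u) ≤ 4 * klFun (1 + β * u) := by
  have hd (x : ℝ) (hx : x ∈ interior (Set.Ici (0 : ℝ))) :
      HasDerivAt (fun u : ℝ => 4 * klFun (1 + β * u) - klFun (1 + u))
        (4 * (Real.log (1 + β * x) * β) - Real.log (1 + x)) x := by
    rw [interior_Ici, Set.mem_Ioi] at hx
    have hkl : HasDerivAt (fun v : ℝ => klFun (1 + v)) (Real.log (1 + x)) x :=
      (hasDerivAt_klFun (x := 1 + x) (by linarith)).comp_const_add 1 x
    have hlin : HasDerivAt (fun v : ℝ => 1 + β * v) β x := by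
      simpa using ((hasDerivAt_id x).const_mul β).const_add 1
    exact (((hasDerivAt_klFun (x := 1 + β * x) (by positivity)).comp x hlin).const_mul 4).sub hkl
  have hmono : MonotoneOn (fun u : ℝ => 4 * klFun (1 + β * u) - klFun (1 + u)) (Set.Ici 0) := by
    refine monotoneOn_of_deriv_nonneg (convex_Ici _) (Continuous.continuousOn (by fun_prop))
      (fun x hx => (hd x hx).differentiableAt.differentiableWithinAt) fun x hx => ?_
    rw [(hd x hx).deriv]
    rw [interior_Ici, Set.mem_Ioi] at hx
    have hβx : 0 < β * x := by positivity
    have hlog : Real.log (1 + x) ≤ 2 * Real.log (1 + β * x) := by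
      rw [← Real.log_rpow (by positivity), Real.rpow_two]
      exact Real.log_le_log (by positivity) (by nlinarith)
    have hlog0 : 0 ≤ Real.log (1 + β * x) := Real.log_nonneg (by linarith)
    nlinarith
  have h := hmono Set.self_mem_Ici hu hu
  simp only [mul_zero, add_zero, klFun_one, sub_zero] at h
  linarith

theorem klFun_le_mul_klFun {β u : ℝ} (hβ : 1 / 2 ≤ β) (hβ' : β ≤ 1) (hu : -1 ≤ u) :
    klFun (1 + u) ≤ 8 * klFun (1 + β * u) := by
  rcases le_total 0 u with h | h
  · have h' : 0 ≤ klFun (1 + β * u) := klFun_nonneg (by positivity)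
    linarith [klFun_le_mul_klFun_of_nonneg hβ h]
  · have hsq : (1 / 2) ^ 2 * u ^ 2 ≤ (β * u) ^ 2 := by
      rw [mul_pow]
      gcongr
    calc klFun (1 + u) ≤ u ^ 2 := by simpa using klFun_le_sq (x := 1 + u) (by linarith)
      _ ≤ 8 * ((β * u) ^ 2 / 2) := by linarith
      _ ≤ 8 * klFun (1 + β * u) := by
        gcongr
        exact sq_half_le_klFun (by nlinarith) (by nlinarith)

end KlFun

/-! ### Pólya urns -/

section Polya

open InformationTheory

variable {A : Type*} [Fintype A]

/-- The likelihood ratio, with respect to the law `p`, of a sample with letter counts `N` under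
the Pólya urn scheme with initial composition `s * p`. Letters with `p a = 0` must have `N a = 0`:
division by zero would make the ratio vanish instead of being infinite. -/
def polyaRatio (p : A → ℝ) (s : ℝ) (N : A → ℕ) : ℝ :=
  (∏ a, ∏ i ∈ Finset.range (N a), ((s * p a + i) / p a)) /
    ∏ i ∈ Finset.range (∑ a, N a), (s + i)

theorem polyaRatio_nonneg {p : A → ℝ} (hp : ∀ a, 0 ≤ p a) {s : ℝ} (hs : 0 ≤ s) (N : A → ℕ) :
    0 ≤ polyaRatio p s N :=
  div_nonneg (Finset.prod_nonneg fun a _ => Finset.prod_nonneg fun i _ =>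
      div_nonneg (by have := hp a; positivity) (hp a))
    (Finset.prod_nonneg fun i _ => by positivity)

theorem polyaRatio_zero (p : A → ℝ) (s : ℝ) : polyaRatio p s 0 = 1 := by
  simp [polyaRatio]

theorem polyaRatio_add_single [DecidableEq A] (p : A → ℝ) (s : ℝ) (N : A → ℕ) (a : A) :
    polyaRatio p s (N + Pi.single a 1) =
      polyaRatio p s N * ((s * p a + N a) / p a / (s + ∑ c, N c)) := by
  have hsum : ∑ c, (N + Pi.single a 1 : A → ℕ) c = ∑ c, N c + 1 := by
    simp [Finset.sum_add_distrib]
  have hletter (c : A) : ∏ i ∈ Finset.range ((N + Pi.single a 1 : A → ℕ) c), ((s * p c + i) / p c) =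
      (∏ i ∈ Finset.range (N c), ((s * p c + i) / p c)) *
        if c = a then (s * p a + N a) / p a else 1 := by
    rcases eq_or_ne c a with rfl | hc
    · rw [Pi.add_apply, Pi.single_eq_same, Finset.prod_range_succ, if_pos rfl]
    · simp [hc]
  rw [polyaRatio, polyaRatio, hsum, Finset.prod_congr rfl fun c _ => hletter c,
    Finset.prod_mul_distrib, Fintype.prod_ite_eq', Finset.prod_range_succ, div_mul_div_comm]

theorem sum_mul_polyaRatio_add_single_le [DecidableEq A] {p : A → ℝ} (hp : p ∈ stdSimplex ℝ A)
    {s : ℝ} (hs : 0 < s) (N : A → ℕ) :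
    ∑ a, p a * polyaRatio p s (N + Pi.single a 1) ≤ polyaRatio p s N := by
  have hT : 0 < s + ∑ c, (N c : ℝ) := by positivity
  have hR := polyaRatio_nonneg hp.1 hs.le N
  have hletter (a : A) : p a * polyaRatio p s (N + Pi.single a 1) ≤
      polyaRatio p s N * ((s * p a + N a) / (s + ∑ c, (N c : ℝ))) := by
    rw [polyaRatio_add_single]
    push_cast
    rcases (hp.1 a).eq_or_lt with ha | ha
    · rw [← ha, zero_mul]
      positivity
    · apply le_of_eq
      field_simp
  calc ∑ a, p a * polyaRatio p s (N + Pi.single a 1)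
      ≤ ∑ a, polyaRatio p s N * ((s * p a + N a) / (s + ∑ c, (N c : ℝ))) :=
        Finset.sum_le_sum fun a _ => hletter a
    _ = polyaRatio p s N := by
        rw [← Finset.mul_sum, ← Finset.sum_div, Finset.sum_add_distrib, ← Finset.mul_sum, hp.2,
          mul_one, div_self hT.ne', mul_one]

theorem polyaRatio_factor_pos {w s : ℝ} {n i : ℕ} (hw : 0 ≤ w) (hn : w = 0 → n = 0) (hs : 0 < s)
    (hi : i ∈ Finset.range n) : 0 < (s * w + i) / w := by
  have hw0 : 0 < w := hw.lt_of_ne' fun h => by simp [hn h] at hi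
  positivity

theorem polyaRatio_pos {p : A → ℝ} (hp : ∀ a, 0 ≤ p a) {N : A → ℕ}
    (hpN : ∀ a, p a = 0 → N a = 0) {s : ℝ} (hs : 0 < s) : 0 < polyaRatio p s N :=
  div_pos
    (Finset.prod_pos fun _ _ => Finset.prod_pos fun _ => polyaRatio_factor_pos (hp _) (hpN _) hs)
    (Finset.prod_pos fun _ _ => by positivity)

theorem log_polyaRatio {p : A → ℝ} (hp : ∀ a, 0 ≤ p a) {N : A → ℕ}
    (hpN : ∀ a, p a = 0 → N a = 0) {s : ℝ} (hs : 0 < s) :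
    Real.log (polyaRatio p s N) =
      ∑ a, ∑ i ∈ Finset.range (N a), Real.log ((s * p a + i) / p a) -
        ∑ i ∈ Finset.range (∑ a, N a), Real.log (s + i) := by
  have hfactor (a : A) : ∀ i ∈ Finset.range (N a), (s * p a + i) / p a ≠ 0 := fun _ hi =>
    (polyaRatio_factor_pos (hp a) (hpN a) hs hi).ne'
  have hden : ∀ i ∈ Finset.range (∑ a, N a), s + (i : ℝ) ≠ 0 := fun _ _ => by positivity
  rw [polyaRatio, Real.log_div (Finset.prod_ne_zero_iff.2 fun a _ =>
      Finset.prod_ne_zero_iff.2 (hfactor a)) (Finset.prod_ne_zero_iff.2 hden),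
    Real.log_prod fun a _ => Finset.prod_ne_zero_iff.2 (hfactor a), Real.log_prod hden]
  exact congrArg (· - _) (Finset.sum_congr rfl fun a _ => Real.log_prod (hfactor a))

/-- The logarithm of the maximal likelihood ratio, with respect to the law `p`, of a sample with
letter counts `N`. -/
def maxLogRatio (p : A → ℝ) (N : A → ℕ) : ℝ :=
  ∑ a, N a * Real.log (N a / ((∑ c, (N c : ℝ)) * p a))

theorem sum_mul_log_div_le_maxLogRatio {p q : A → ℝ} {N : A → ℕ} (hq : q ∈ stdSimplex ℝ A)
    (hpN : ∀ a, N a ≠ 0 → 0 < p a) (hqN : ∀ a, N a ≠ 0 → 0 < q a) :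
    ∑ a, N a * Real.log (q a / p a) ≤ maxLogRatio p N := by
  set T : ℝ := ∑ c, (N c : ℝ) with hT
  have hletter (a : A) : N a * Real.log (q a / p a) - N a * Real.log (N a / (T * p a)) ≤
      T * q a - N a := by
    by_cases ha : N a = 0
    · have := hq.1 a
      simp only [ha, Nat.cast_zero, zero_mul, sub_zero]
      positivity
    · have hpa := hpN a ha
      have hqa := hqN a ha
      have hTpos : 0 < T := Finset.sum_pos' (fun c _ => by positivity) ⟨a, Finset.mem_univ a,
        by positivity⟩
      have hlog : Real.log (q a / p a) - Real.log (N a / (T * p a)) =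
          Real.log (T * q a / N a) := by
        rw [← Real.log_div (by positivity) (by positivity)]
        congr 1
        field_simp
      calc N a * Real.log (q a / p a) - N a * Real.log (N a / (T * p a))
          = N a * Real.log (T * q a / N a) := by rw [← mul_sub, hlog]
        _ ≤ N a * (T * q a / N a - 1) := by
          gcongr
          exact Real.log_le_sub_one_of_pos (by positivity)
        _ = T * q a - N a := by field_simp
  have hsum := Finset.sum_le_sum fun a (_ : a ∈ Finset.univ) => hletter a
  rw [Finset.sum_sub_distrib, Finset.sum_sub_distrib, ← Finset.mul_sum, hq.2, mul_one, ← hT,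
    sub_self] at hsum
  rw [maxLogRatio, ← hT]
  linarith

theorem maxLogRatio_eq_sum_klFun {p : A → ℝ} (hp : p ∈ stdSimplex ℝ A) {N : A → ℕ}
    (hpN : ∀ a, p a = 0 → N a = 0) {T : ℝ} (hT : T = ∑ a, (N a : ℝ)) (hT0 : T ≠ 0) :
    maxLogRatio p N = ∑ a, T * p a * klFun (N a / (T * p a)) := by
  have hletter (a : A) : N a * Real.log (N a / (T * p a)) =
      T * p a * klFun (N a / (T * p a)) + (N a - T * p a) := by
    by_cases ha : p a = 0
    · simp [ha, hpN a ha]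
    · rw [mul_klFun_div (mul_ne_zero hT0 ha)]
      ring
  rw [maxLogRatio, ← hT, Finset.sum_congr rfl fun a _ => hletter a, Finset.sum_add_distrib,
    Finset.sum_sub_distrib, ← Finset.mul_sum, hp.2, ← hT, mul_one, sub_self, add_zero]

theorem klFun_sub_sub_le_sum_log_div {w δ s : ℝ} {N : ℕ} (hδ : 0 < δ) (hw : δ ≤ w) (hs : 0 < s)
    (hN : N ≤ 2 * s) :
    klFun (s * w + N) - klFun (s * w) - N * Real.log w - Real.log (1 + 2 / δ) ≤
      ∑ i ∈ Finset.range N, Real.log ((s * w + i) / w) := by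
  have hw0 : 0 < w := hδ.trans_le hw
  have hsw : 0 < s * w := by positivity
  have hsplit : ∑ i ∈ Finset.range N, Real.log ((s * w + i) / w) =
      ∑ i ∈ Finset.range N, Real.log (s * w + i) - N * Real.log w := by
    rw [Finset.sum_congr rfl fun (i : ℕ) _ =>
      Real.log_div (show s * w + (i : ℝ) ≠ 0 by positivity) hw0.ne']
    simp
  have hcost : Real.log (s * w + N) - Real.log (s * w) ≤ Real.log (1 + 2 / δ) := by
    rw [← Real.log_div (by positivity) hsw.ne', add_div, div_self hsw.ne']
    refine Real.log_le_log (by positivity) (add_le_add le_rfl ?_)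
    rw [div_le_div_iff₀ hsw hδ]
    calc (N : ℝ) * δ ≤ (2 * s) * w := by gcongr
      _ = 2 * (s * w) := by ring
  linarith [klFun_sub_sub_le_sum_log_add hsw N]

theorem sum_klFun_le_log_polyaRatio {p : A → ℝ} (hp : p ∈ stdSimplex ℝ A) {δ : ℝ} (hδ : 0 < δ)
    (hpδ : ∀ a, 0 < p a → δ ≤ p a) {N : A → ℕ} (hpN : ∀ a, p a = 0 → N a = 0) {s T : ℝ}
    (hs : 0 < s) (hT : T = ∑ a, (N a : ℝ)) (hTs : T ≤ 2 * s) :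
    ∑ a, (s + T) * p a * klFun ((s * p a + N a) / ((s + T) * p a)) -
        Fintype.card A * Real.log (1 + 2 / δ) ≤ Real.log (polyaRatio p s N) := by
  have hT0 : 0 ≤ T := hT ▸ by positivity
  have hletter (a : A) : (s + T) * p a * klFun ((s * p a + N a) / ((s + T) * p a)) +
        ((s * p a + N a) * Real.log (s + T) - T * p a - s * Real.log s * p a) -
        Real.log (1 + 2 / δ) ≤
      ∑ i ∈ Finset.range (N a), Real.log ((s * p a + i) / p a) := by
    rcases (hp.1 a).eq_or_lt with ha | ha
    · have : 0 ≤ Real.log (1 + 2 / δ) := Real.log_nonneg (le_add_of_nonneg_right (by positivity))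
      simpa [← ha, hpN a ha.symm] using this
    · have hNT : (N a : ℝ) ≤ T := hT ▸
        Finset.single_le_sum (f := fun c => (N c : ℝ)) (fun c _ => by positivity)
          (Finset.mem_univ a)
      have h := klFun_sub_sub_le_sum_log_div hδ (hpδ a ha) hs (hNT.trans hTs)
      rw [mul_klFun_div (by positivity), Real.log_div (by positivity) (by positivity),
        Real.log_mul (by positivity) ha.ne']
      simp only [klFun, Real.log_mul hs.ne' ha.ne'] at h
      linarith
  have hsum := Finset.sum_le_sum fun a (_ : a ∈ Finset.univ) => hletter a
  rw [Finset.sum_sub_distrib, Finset.sum_add_distrib, Finset.sum_sub_distrib,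
    Finset.sum_sub_distrib, ← Finset.sum_mul, Finset.sum_add_distrib, ← Finset.mul_sum,
    ← Finset.mul_sum, ← Finset.mul_sum, hp.2, ← hT, Finset.sum_const, Finset.card_univ,
    nsmul_eq_mul] at hsum
  have hden := sum_log_add_le_klFun_sub hs (∑ a, N a)
  rw [Nat.cast_sum, ← hT] at hden
  rw [log_polyaRatio hp.1 hpN hs]
  linarith [show klFun (s + T) - klFun s = (s + T) * Real.log (s + T) - T - s * Real.log s by
    simp only [klFun]; ring]

theorem maxLogRatio_le_log_polyaRatio {p : A → ℝ} (hp : p ∈ stdSimplex ℝ A) {δ : ℝ} (hδ : 0 < δ)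
    (hpδ : ∀ a, 0 < p a → δ ≤ p a) {N : A → ℕ} (hpN : ∀ a, p a = 0 → N a = 0) {s : ℝ}
    (hs : 0 < s) (hsT : s ≤ ∑ a, (N a : ℝ)) (hTs : ∑ a, (N a : ℝ) ≤ 2 * s) :
    maxLogRatio p N ≤
      8 * (Real.log (polyaRatio p s N) + Fintype.card A * Real.log (1 + 2 / δ)) := by
  obtain ⟨T, hT⟩ : ∃ T : ℝ, T = ∑ a, (N a : ℝ) := ⟨_, rfl⟩
  rw [← hT] at hsT hTs
  have hT0 : 0 < T := hs.trans_le hsT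
  have hletter (a : A) : T * p a * klFun (N a / (T * p a)) ≤
      8 * ((s + T) * p a * klFun ((s * p a + N a) / ((s + T) * p a))) := by
    rcases (hp.1 a).eq_or_lt with ha | ha
    · simp [← ha]
    · have hmix : (s * p a + N a) / ((s + T) * p a) =
          1 + T / (s + T) * (N a / (T * p a) - 1) := by
        field_simp
        ring
      have hkl : klFun (N a / (T * p a)) ≤ 8 * klFun ((s * p a + N a) / ((s + T) * p a)) := by
        have hx : 0 ≤ N a / (T * p a) := by positivity
        have h := klFun_le_mul_klFun (β := T / (s + T)) (u := N a / (T * p a) - 1)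
          (by rw [div_le_div_iff₀ (by norm_num) (by positivity)]; linarith)
          (by rw [div_le_one (by positivity)]; linarith) (by linarith)
        rwa [add_sub_cancel, ← hmix] at h
      calc T * p a * klFun (N a / (T * p a))
          ≤ (s + T) * p a * (8 * klFun ((s * p a + N a) / ((s + T) * p a))) := by
            gcongr
            · exact klFun_nonneg (by positivity)
            · linarith
        _ = _ := by ring
  calc maxLogRatio p N = ∑ a, T * p a * klFun (N a / (T * p a)) :=
        maxLogRatio_eq_sum_klFun hp hpN hT hT0.ne'
    _ ≤ 8 * ∑ a, (s + T) * p a * klFun ((s * p a + N a) / ((s + T) * p a)) := by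
        rw [Finset.mul_sum]
        exact Finset.sum_le_sum fun a _ => hletter a
    _ ≤ 8 * (Real.log (polyaRatio p s N) + Fintype.card A * Real.log (1 + 2 / δ)) := by
        gcongr
        linarith [sum_klFun_le_log_polyaRatio hp hδ hpδ hpN hs hT hTs]

end Polya

/-! ### Mixtures of Pólya urns -/

section Mixture

variable {A : Type*}

/-- The probabilities of `p` as a real vector, which lies in the simplex `stdSimplex ℝ A`. -/
def probVec (p : PMF A) : A → ℝ := fun a => (p a).toReal

theorem ofReal_probVec (p : PMF A) (a : A) : ENNReal.ofReal (probVec p a) = p a :=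
  ENNReal.ofReal_toReal (p.apply_ne_top a)

theorem probVec_pos_iff {p : PMF A} {a : A} : 0 < probVec p a ↔ 0 < p a := by
  rw [← ofReal_probVec p a, ENNReal.ofReal_pos]

variable [Fintype A]

theorem probVec_mem_stdSimplex (p : PMF A) : probVec p ∈ stdSimplex ℝ A := by
  refine ⟨fun a => ENNReal.toReal_nonneg, ?_⟩
  have h : ∑ a, p a = 1 := (tsum_fintype _).symm.trans p.tsum_coe
  simp only [probVec]
  rw [← ENNReal.toReal_sum fun a _ => p.apply_ne_top a, h, ENNReal.toReal_one]

/-- The mixture of the likelihood ratios of Pólya urns of initial masses `2 ^ k`, which does not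
need to know the sample size; the weights `1 / ((k + 1) * (k + 2))` sum to `1`. -/
def mixtureRatio (p : A → ℝ) (N : A → ℕ) : ENNReal :=
  ∑' k : ℕ, ENNReal.ofReal (1 / ((k + 1) * (k + 2))) * ENNReal.ofReal (polyaRatio p (2 ^ k) N)

theorem mixtureRatio_zero_le_one (p : A → ℝ) : mixtureRatio p 0 ≤ 1 := by
  have htelescope (n : ℕ) :
      ∑ k ∈ Finset.range n, (1 / (((k : ℝ) + 1) * (k + 2))) = 1 - 1 / (n + 1) := by
    induction n with
    | zero => simp
    | succ n ih =>
      rw [Finset.sum_range_succ, ih]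
      push_cast
      field_simp
      ring
  refine ENNReal.tsum_le_of_sum_range_le fun n => ?_
  simp only [polyaRatio_zero, ENNReal.ofReal_one, mul_one]
  rw [← ENNReal.ofReal_sum_of_nonneg fun k _ => by positivity, htelescope, ← ENNReal.ofReal_one]
  exact ENNReal.ofReal_le_ofReal (sub_le_self _ (by positivity))

theorem sum_mul_mixtureRatio_add_single_le [DecidableEq A] (p : PMF A) (N : A → ℕ) :
    ∑ a, p a * mixtureRatio (probVec p) (N + Pi.single a 1) ≤ mixtureRatio (probVec p) N := by
  have hp := probVec_mem_stdSimplex p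
  simp only [mixtureRatio, ← ENNReal.tsum_mul_left]
  rw [← Summable.tsum_finsetSum fun a _ => ENNReal.summable]
  refine ENNReal.tsum_le_tsum fun k => ?_
  calc ∑ a, p a * (ENNReal.ofReal (1 / ((k + 1) * (k + 2))) *
        ENNReal.ofReal (polyaRatio (probVec p) (2 ^ k) (N + Pi.single a 1)))
      = ENNReal.ofReal (1 / ((k + 1) * (k + 2))) * ENNReal.ofReal (∑ a, probVec p a *
          polyaRatio (probVec p) (2 ^ k) (N + Pi.single a 1)) := by
        rw [ENNReal.ofReal_sum_of_nonneg fun a _ =>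
          mul_nonneg (hp.1 a) (polyaRatio_nonneg hp.1 (by positivity) _), Finset.mul_sum]
        refine Finset.sum_congr rfl fun a _ => ?_
        rw [ENNReal.ofReal_mul (hp.1 a), ofReal_probVec]
        ring
    _ ≤ _ := by
        gcongr
        exact sum_mul_polyaRatio_add_single_le hp (by positivity) N

theorem maxLogRatio_le_log_polyaRatio_two_pow {p : A → ℝ} (hp : p ∈ stdSimplex ℝ A) {δ : ℝ}
    (hδ : 0 < δ) (hpδ : ∀ a, 0 < p a → δ ≤ p a) {N : A → ℕ} (hpN : ∀ a, p a = 0 → N a = 0) :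
    maxLogRatio p N ≤ 8 * (Real.log (polyaRatio p (2 ^ Nat.log 2 (∑ a, N a)) N) +
      Fintype.card A * Real.log (1 + 2 / δ)) := by
  rcases eq_or_ne (∑ a, N a) 0 with hT | hT
  · obtain rfl : N = 0 := by
      funext a
      simpa using Finset.sum_eq_zero_iff.1 hT a (Finset.mem_univ a)
    have hlog : 0 ≤ Real.log (1 + 2 / δ) := Real.log_nonneg (le_add_of_nonneg_right (by positivity))
    simp only [maxLogRatio, polyaRatio_zero, Pi.zero_apply, Nat.cast_zero, zero_mul, zero_div,
      Finset.sum_const_zero, Real.log_one, zero_add]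
    positivity
  · have hlow : ((2 ^ Nat.log 2 (∑ a, N a) : ℕ) : ℝ) ≤ ((∑ a, N a : ℕ) : ℝ) :=
      Nat.cast_le.2 (Nat.pow_log_le_self 2 hT)
    have hupp : ((∑ a, N a : ℕ) : ℝ) ≤ ((2 ^ (Nat.log 2 (∑ a, N a) + 1) : ℕ) : ℝ) :=
      Nat.cast_le.2 (Nat.lt_pow_succ_log_self (by norm_num) _).le
    push_cast at hlow hupp
    rw [pow_succ'] at hupp
    exact maxLogRatio_le_log_polyaRatio hp hδ hpδ hpN (by positivity) hlow hupp

/-- The cost, per context, of using a mixture in place of the maximum likelihood. -/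
def mixtureCost (A : Type*) [Fintype A] (δ : ℝ) (n : ℕ) : ℝ :=
  Fintype.card A * Real.log (1 + 2 / δ) + 2 * Real.log (Nat.log 2 n + 2)

theorem mixtureCost_mono (δ : ℝ) : Monotone (mixtureCost A δ) := fun m n hmn => by
  have : (Nat.log 2 m : ℝ) ≤ Nat.log 2 n := Nat.cast_le.2 (Nat.log_mono_right hmn)
  rw [mixtureCost, mixtureCost]
  gcongr

theorem mixtureCost_nonneg {δ : ℝ} (hδ : 0 < δ) (n : ℕ) : 0 ≤ mixtureCost A δ n := by
  have h₁ : 0 ≤ Real.log (1 + 2 / δ) := Real.log_nonneg (le_add_of_nonneg_right (by positivity))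
  have h₂ : 0 ≤ Real.log (Nat.log 2 n + 2) := Real.log_nonneg (by norm_cast; omega)
  rw [mixtureCost]
  positivity

theorem exp_le_mixtureRatio {p : A → ℝ} (hp : p ∈ stdSimplex ℝ A) {δ : ℝ} (hδ : 0 < δ)
    (hpδ : ∀ a, 0 < p a → δ ≤ p a) {N : A → ℕ} (hpN : ∀ a, p a = 0 → N a = 0) {n : ℕ}
    (hn : ∑ a, N a ≤ n) :
    ENNReal.ofReal (Real.exp (maxLogRatio p N / 8 - mixtureCost A δ n)) ≤ mixtureRatio p N := by
  set k := Nat.log 2 (∑ a, N a)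
  have hpolya : Real.exp (maxLogRatio p N / 8 - Fintype.card A * Real.log (1 + 2 / δ)) ≤
      polyaRatio p (2 ^ k) N := by
    rw [← Real.le_log_iff_exp_le (polyaRatio_pos hp.1 hpN (by positivity))]
    linarith [maxLogRatio_le_log_polyaRatio_two_pow hp hδ hpδ hpN]
  have hweight : Real.exp (-(2 * Real.log (Nat.log 2 n + 2))) ≤
      1 / (((k : ℝ) + 1) * (k + 2)) := by
    have hkn : (k : ℝ) ≤ Nat.log 2 n := Nat.cast_le.2 (Nat.log_mono_right hn)
    rw [Real.exp_neg, mul_comm, Real.exp_mul, Real.exp_log (by positivity), Real.rpow_two,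
      ← one_div, sq]
    apply one_div_le_one_div_of_le (by positivity)
    gcongr
    norm_num
  calc ENNReal.ofReal (Real.exp (maxLogRatio p N / 8 - mixtureCost A δ n))
      = ENNReal.ofReal (Real.exp (-(2 * Real.log (Nat.log 2 n + 2))) *
          Real.exp (maxLogRatio p N / 8 - Fintype.card A * Real.log (1 + 2 / δ))) := by
        rw [← Real.exp_add, mixtureCost]
        ring_nf
    _ ≤ ENNReal.ofReal (1 / (((k : ℝ) + 1) * (k + 2)) * polyaRatio p (2 ^ k) N) := by gcongr
    _ ≤ mixtureRatio p N := by
        rw [ENNReal.ofReal_mul (by positivity)]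
        exact ENNReal.le_tsum k

end Mixture

/-! ### Contexts -/

section Contexts

variable {A : Type*} {r : ℕ}

open Classical in
/-- The numbers of occurrences of the letters after the word `b` in `x_{1:m+r}`. -/
def contextCount (m : ℕ) (x : ℕ → A) (b : Fin r → A) : A → ℕ :=
  ∑ j ∈ Finset.range m, if block x j r = b then Pi.single (x (j + r)) 1 else 0

theorem contextCount_congr {m : ℕ} {x y : ℕ → A} (h : block x 0 (m + r) = block y 0 (m + r))
    (b : Fin r → A) : contextCount m x b = contextCount m y b := by
  rw [block_zero_eq_iff] at h
  refine Finset.sum_congr rfl fun j hj => ?_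
  rw [Finset.mem_range] at hj
  rw [h (j + r) (by omega), block_congr (y := y) fun i hi => h i (by omega)]

theorem contextCount_zero (x : ℕ → A) (b : Fin r → A) : contextCount 0 x b = 0 := rfl

open Classical in
theorem contextCount_succ (m : ℕ) (x : ℕ → A) (b : Fin r → A) :
    contextCount (m + 1) x b =
      contextCount m x b + if block x m r = b then Pi.single (x (m + r)) 1 else 0 :=
  Finset.sum_range_succ _ _

open Classical in
theorem contextCount_succ_update (m : ℕ) (x : ℕ → A) (a : A) (b : Fin r → A) :
    contextCount (m + 1) (Function.update x (m + r) a) b =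
      contextCount m x b + if block x m r = b then Pi.single a 1 else 0 := by
  rw [contextCount_succ, block_update le_rfl, Function.update_self,
    contextCount_congr (block_update (zero_add _).le a)]

theorem sum_contextCount_le [Fintype A] (m : ℕ) (x : ℕ → A) (b : Fin r → A) :
    ∑ a, contextCount m x b a ≤ m := by
  classical
  induction m with
  | zero => simp [contextCount_zero]
  | succ m ih =>
    have hlast : ∑ a, (if block x m r = b then Pi.single (x (m + r)) 1 else 0 : A → ℕ) a ≤ 1 := by
      split_ifs <;> simp
    rw [contextCount_succ]
    simp only [Pi.add_apply, Finset.sum_add_distrib]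
    omega

theorem sum_range_eq_sum_contextCount_mul [Fintype A] (m : ℕ) (x : ℕ → A)
    (h : (Fin r → A) → A → ℝ) :
    ∑ j ∈ Finset.range m, h (block x j r) (x (j + r)) =
      ∑ b, ∑ a, contextCount m x b a * h b a := by
  classical
  induction m with
  | zero => simp [contextCount_zero]
  | succ m ih =>
    have hlast : ∑ b, ∑ a, ((if block x m r = b then Pi.single (x (m + r)) 1 else 0 : A → ℕ) a : ℝ)
        * h b a = h (block x m r) (x (m + r)) := by
      simp [apply_ite, ite_apply, Pi.single_apply, Finset.sum_ite_eq]
    simp only [contextCount_succ, Finset.sum_range_succ, ih, Pi.add_apply, Nat.cast_add, add_mul,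
      Finset.sum_add_distrib, hlast]

theorem exists_of_contextCount_ne_zero {m : ℕ} {x : ℕ → A} {b : Fin r → A} {a : A}
    (h : contextCount m x b a ≠ 0) : ∃ j < m, block x j r = b ∧ x (j + r) = a := by
  classical
  rw [contextCount, Finset.sum_apply] at h
  obtain ⟨j, hjm, hj⟩ := Finset.exists_ne_zero_of_sum_ne_zero h
  have hb : block x j r = b := by
    by_contra hb
    simp [hb] at hj
  refine ⟨j, Finset.mem_range.1 hjm, hb, ?_⟩
  by_contra ha
  simp [hb, ha] at hj

/-- The last `r` letters of a word. -/
def suffix {n : ℕ} (r : ℕ) (h : r ≤ n) (x : Fin n → A) : Fin r → A :=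
  fun i => x ⟨n - r + i, by omega⟩

theorem suffix_block {n : ℕ} (h : r ≤ n) (x : ℕ → A) (m : ℕ) :
    suffix r h (block x m n) = block x (m + (n - r)) r := by
  funext i
  simp [suffix, block, add_assoc]

variable [MeasurableSpace A] {P : Measure (ℕ → A)} {q : (Fin r → A) → PMF A}

theorem isTransition_of_succ
    (h : ∀ (m : ℕ) (x : ℕ → A), wordProb P (block x 0 (m + r + 1)) =
      wordProb P (block x 0 (m + r)) * q (block x m r) (x (m + r))) : IsTransition P r q := by
  intro m x
  induction m with
  | zero => simp
  | succ m ih =>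
    rw [Finset.prod_range_succ, ← mul_assoc, ← ih, ← show m + r + 1 = r + (m + 1) by omega, h,
      add_comm m r]

theorem IsTransition.of_le (hq : IsTransition P r q) {n : ℕ} (h : r ≤ n) :
    IsTransition P n fun b => q (suffix r h b) := by
  refine isTransition_of_succ fun m x => ?_
  have hstep := hq.wordProb_succ (m + (n - r)) x
  rw [show m + (n - r) + r = m + n by omega] at hstep
  rw [hstep, suffix_block]

end Contexts

/-! ### The mixture likelihood -/

section MixtureLikelihood

variable {A : Type*} [Fintype A] {r : ℕ}

/-- The likelihood ratio of `x_{1:m+r}` for the chain of order `r` whose transition probabilities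
are independent mixtures of Pólya urns. -/
def mixtureLikelihood (q : (Fin r → A) → PMF A) (m : ℕ) (x : ℕ → A) : ENNReal :=
  ∏ b, mixtureRatio (probVec (q b)) (contextCount m x b)

theorem mixtureLikelihood_zero_le_one (q : (Fin r → A) → PMF A) (x : ℕ → A) :
    mixtureLikelihood q 0 x ≤ 1 :=
  Finset.prod_le_one' fun b _ => by
    rw [contextCount_zero]
    exact mixtureRatio_zero_le_one _

theorem mixtureLikelihood_factorsThrough (q : (Fin r → A) → PMF A) (m : ℕ) :
    (mixtureLikelihood q m).FactorsThrough fun x => block x 0 (m + r) := fun x y h => by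
  simp only [mixtureLikelihood, contextCount_congr h]

theorem sum_mul_mixtureLikelihood_update_le (q : (Fin r → A) → PMF A) (m : ℕ) (x : ℕ → A) :
    ∑ a, q (block x m r) a * mixtureLikelihood q (m + 1) (Function.update x (m + r) a) ≤
      mixtureLikelihood q m x := by
  classical
  set u := block x m r with hu
  have hsplit (a : A) : mixtureLikelihood q (m + 1) (Function.update x (m + r) a) =
      mixtureRatio (probVec (q u)) (contextCount m x u + Pi.single a 1) *
        ∏ b ∈ Finset.univ.erase u, mixtureRatio (probVec (q b)) (contextCount m x b) := by
    rw [mixtureLikelihood, ← Finset.mul_prod_erase _ _ (Finset.mem_univ u),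
      contextCount_succ_update, if_pos hu.symm]
    congr 1
    refine Finset.prod_congr rfl fun b hb => ?_
    rw [contextCount_succ_update, if_neg (Finset.ne_of_mem_erase hb).symm, add_zero]
  simp only [hsplit, ← mul_assoc]
  rw [mixtureLikelihood, ← Finset.sum_mul, ← Finset.mul_prod_erase _ _ (Finset.mem_univ u)]
  gcongr
  exact sum_mul_mixtureRatio_add_single_le (q u) _

theorem sum_maxLogRatio_le {q : (Fin r → A) → PMF A} {δ : ℝ} (hδ : 0 < δ)
    (hqδ : ∀ b a, 0 < probVec (q b) a → δ ≤ probVec (q b) a) {m : ℕ} {x : ℕ → A}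
    (hx : ∀ j < m, 0 < q (block x j r) (x (j + r))) {t : ℝ} (ht : 0 < t)
    (hmix : mixtureLikelihood q m x ≤ ENNReal.ofReal t) :
    ∑ b, maxLogRatio (probVec (q b)) (contextCount m x b) ≤
      8 * (Real.log t + (Fintype.card A : ℝ) ^ r * mixtureCost A δ m) := by
  have hzero (b : Fin r → A) (a : A) (ha : probVec (q b) a = 0) : contextCount m x b a = 0 := by
    by_contra h
    obtain ⟨j, hj, rfl, rfl⟩ := exists_of_contextCount_ne_zero h
    exact (probVec_pos_iff.2 (hx j hj)).ne' ha
  have hexp : ENNReal.ofReal (Real.exp (∑ b : Fin r → A,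
      (maxLogRatio (probVec (q b)) (contextCount m x b) / 8 - mixtureCost A δ m))) ≤
      mixtureLikelihood q m x := by
    rw [Real.exp_sum, ENNReal.ofReal_prod_of_nonneg fun b _ => (Real.exp_pos _).le]
    exact Finset.prod_le_prod' fun b _ => exp_le_mixtureRatio (probVec_mem_stdSimplex _) hδ
      (hqδ b) (hzero b) (sum_contextCount_le m x b)
  have hsum := (Real.le_log_iff_exp_le ht).2
    ((ENNReal.ofReal_le_ofReal_iff ht.le).1 (hexp.trans hmix))
  simp only [Finset.sum_sub_distrib, ← Finset.sum_div, Finset.sum_const, Finset.card_univ,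
    Fintype.card_fun, Fintype.card_fin, nsmul_eq_mul, Nat.cast_pow] at hsum
  linarith

theorem prod_le_exp_sum_maxLogRatio_mul_prod {q : (Fin r → A) → PMF A} {m : ℕ} {x : ℕ → A}
    (hx : ∀ j < m, 0 < q (block x j r) (x (j + r))) (p : (Fin r → A) → PMF A) :
    ∏ j ∈ Finset.range m, p (block x j r) (x (j + r)) ≤
      ENNReal.ofReal (Real.exp (∑ b, maxLogRatio (probVec (q b)) (contextCount m x b))) *
        ∏ j ∈ Finset.range m, q (block x j r) (x (j + r)) := by
  by_cases! hzero : ∃ j < m, p (block x j r) (x (j + r)) = 0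
  · obtain ⟨j, hj, hj0⟩ := hzero
    rw [Finset.prod_eq_zero (Finset.mem_range.2 hj) hj0]
    exact zero_le
  let ratio (b : Fin r → A) (a : A) : ℝ := probVec (p b) a / probVec (q b) a
  have hlog : ∑ j ∈ Finset.range m, Real.log (ratio (block x j r) (x (j + r))) ≤
      ∑ b, maxLogRatio (probVec (q b)) (contextCount m x b) := by
    rw [sum_range_eq_sum_contextCount_mul m x fun b a => Real.log (ratio b a)]
    refine Finset.sum_le_sum fun b _ =>
      sum_mul_log_div_le_maxLogRatio (probVec_mem_stdSimplex _) (fun a h => ?_) fun a h => ?_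
    all_goals
      obtain ⟨j, hj, rfl, rfl⟩ := exists_of_contextCount_ne_zero h
      apply probVec_pos_iff.2
    · exact hx j hj
    · exact pos_iff_ne_zero.2 (hzero j hj)
  have hfactor (j : ℕ) (hj : j ∈ Finset.range m) : p (block x j r) (x (j + r)) =
      ENNReal.ofReal (Real.exp (Real.log (ratio (block x j r) (x (j + r))))) *
        q (block x j r) (x (j + r)) := by
    rw [Finset.mem_range] at hj
    have hp := probVec_pos_iff.2 (pos_iff_ne_zero.2 (hzero j hj))
    have hq := probVec_pos_iff.2 (hx j hj)
    rw [Real.exp_log (div_pos hp hq), ← ofReal_probVec (q _),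
      ← ENNReal.ofReal_mul (div_pos hp hq).le, div_mul_cancel₀ _ hq.ne', ofReal_probVec]
  rw [Finset.prod_congr rfl hfactor, Finset.prod_mul_distrib,
    ← ENNReal.ofReal_prod_of_nonneg fun b _ => (Real.exp_pos _).le, ← Real.exp_sum]
  gcongr

end MixtureLikelihood

/-! ### Likelihood ratios of all orders -/

section LikelihoodRatio

theorem exists_pos_forall_le {ι : Type*} [Finite ι] (f : ι → ℝ) :
    ∃ c : ℝ, 0 < c ∧ ∀ i, 0 < f i → c ≤ f i := by
  rcases isEmpty_or_nonempty {i // 0 < f i} with h | h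
  · exact ⟨1, one_pos, fun i hi => (h.false ⟨i, hi⟩).elim⟩
  · obtain ⟨i, hi⟩ := Finite.exists_min fun i : {i // 0 < f i} => f i
    exact ⟨f i, i.2, fun j hj => hi ⟨j, hj⟩⟩

theorem ofReal_exp_add (x y : ℝ) : ENNReal.ofReal (Real.exp (x + y)) =
    ENNReal.ofReal (Real.exp x) * ENNReal.ofReal (Real.exp y) := by
  rw [Real.exp_add, ENNReal.ofReal_mul (Real.exp_pos x).le]

variable {A : Type*} [MeasurableSpace A] {P : Measure (ℕ → A)} {r : ℕ} {q : (Fin r → A) → PMF A}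

theorem IsTransition.exists_exp_le_wordProb [Finite A] [IsProbabilityMeasure P]
    (hq : IsTransition P r q) :
    ∃ C : ℝ, 0 ≤ C ∧ ∀ x : ℕ → A, (∀ n, 0 < wordProb P (block x 0 n)) → ∀ n, r ≤ n →
      ENNReal.ofReal (Real.exp (-(C * (n + 1)))) ≤ wordProb P (block x 0 n) := by
  obtain ⟨ε, hε, hεle⟩ := exists_pos_forall_le fun u : Fin r → A => (wordProb P u).toReal
  obtain ⟨δ, hδ, hδle⟩ := exists_pos_forall_le fun x : (Fin r → A) × A => probVec (q x.1) x.2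
  obtain ⟨c, hc, hcε, hcδ, hc1⟩ : ∃ c : ℝ, 0 < c ∧ c ≤ ε ∧ c ≤ δ ∧ c ≤ 1 :=
    ⟨min ε (min δ 1), by positivity, min_le_left _ _, (min_le_right _ _).trans (min_le_left _ _),
      (min_le_right _ _).trans (min_le_right _ _)⟩
  refine ⟨-Real.log c, neg_nonneg.2 (Real.log_nonpos hc.le hc1), fun x hx n hn => ?_⟩
  obtain ⟨m, rfl⟩ := Nat.exists_eq_add_of_le hn
  have hinit : ENNReal.ofReal c ≤ wordProb P (block x 0 r) :=
    ENNReal.ofReal_le_of_le_toReal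
      (hcε.trans (hεle _ (ENNReal.toReal_pos (hx r).ne' (measure_ne_top _ _))))
  have hstep (j : ℕ) : ENNReal.ofReal c ≤ q (block x j r) (x (j + r)) := by
    rw [← ofReal_probVec]
    exact ENNReal.ofReal_le_ofReal (hcδ.trans
      (hδle (block x j r, x (j + r)) (probVec_pos_iff.2 (hq.pos_of_wordProb_pos hx j))))
  calc ENNReal.ofReal (Real.exp (-(-Real.log c * ((r + m : ℕ) + 1))))
      = ENNReal.ofReal c ^ (r + m + 1) := by
        rw [neg_mul, neg_neg, Real.exp_mul, Real.exp_log hc, ← ENNReal.ofReal_pow hc.le]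
        norm_cast
    _ ≤ ENNReal.ofReal c ^ (m + 1) :=
        pow_le_pow_right_of_le_one' (ENNReal.ofReal_le_one.2 hc1) (by omega)
    _ = ENNReal.ofReal c * ∏ _j ∈ Finset.range m, ENNReal.ofReal c := by
        rw [Finset.prod_const, Finset.card_range, pow_succ']
    _ ≤ wordProb P (block x 0 (r + m)) := by
        rw [hq m x]
        exact mul_le_mul' hinit (Finset.prod_le_prod' fun _ _ => hstep _)

variable [Fintype A]

theorem IsTransition.mul_measure_exists_le_mixtureLikelihood [MeasurableSingletonClass A]
    [IsProbabilityMeasure P] (hq : IsTransition P r q) (t : ENNReal) :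
    t * P {ω | ∃ m, t ≤ mixtureLikelihood q m ω} ≤ 1 := by
  classical
  let ℱ : Filtration ℕ (MeasurableSpace.pi : MeasurableSpace (ℕ → A)) :=
    ⟨fun m => blockFiltration A (m + r), fun _ _ h => (blockFiltration A).mono (by omega),
      fun m => (blockFiltration A).le (m + r)⟩
  have hzero : ∫⁻ ω, mixtureLikelihood q 0 ω ∂P ≤ 1 := by
    simpa using lintegral_mono (μ := P) (mixtureLikelihood_zero_le_one q)
  refine (mul_measure_exists_le_lintegral (ℱ := ℱ)
    (fun m => measurable_blockFiltration (mixtureLikelihood_factorsThrough q m)) ?_ t).trans hzero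
  intro m E hE
  have hE' : MeasurableSet E := ℱ.le m E hE
  have hfactors : (E.indicator (mixtureLikelihood q (m + 1))).FactorsThrough
      fun ω => block ω 0 (m + r + 1) := fun x y h => by
    have hY : mixtureLikelihood q (m + 1) x = mixtureLikelihood q (m + 1) y :=
      mixtureLikelihood_factorsThrough q (m + 1) (add_right_comm m 1 r ▸ h)
    simp only [Set.indicator_apply, hY,
      mem_iff_of_measurableSet_blockFiltration hE (block_zero_succ_eq_iff.1 h).1]
  rw [← lintegral_indicator hE', ← lintegral_indicator hE', hq.lintegral_eq hfactors]
  refine lintegral_mono fun ω => ?_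
  have hmem (a : A) : Function.update ω (m + r) a ∈ E ↔ ω ∈ E :=
    mem_iff_of_measurableSet_blockFiltration hE (block_update (by simp) a)
  by_cases hω : ω ∈ E
  · simpa only [Set.indicator_apply, hmem, if_pos hω] using
      sum_mul_mixtureLikelihood_update_le q m ω
  · simp [hmem, hω]

theorem IsTransition.wordProb_mul_le [IsProbabilityMeasure P] (hq : IsTransition P r q) {δ : ℝ}
    (hδ : 0 < δ) (hqδ : ∀ b a, 0 < probVec (q b) a → δ ≤ probVec (q b) a) {x : ℕ → A}
    (hx : ∀ n, 0 < wordProb P (block x 0 n)) {t : ℝ} (ht : 1 ≤ t)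
    (hmix : ∀ m, mixtureLikelihood q m x ≤ ENNReal.ofReal t) {Q : Measure (ℕ → A)}
    (hQ : Q ∈ markovLaws A r) (n : ℕ) :
    wordProb Q (block x 0 n) * wordProb P (block x 0 r) ≤
      ENNReal.ofReal (Real.exp (8 * (Real.log t +
        (Fintype.card A : ℝ) ^ r * mixtureCost A δ n))) * wordProb P (block x 0 n) := by
  obtain ⟨_, p, hp⟩ := mem_markovLaws_iff.1 hQ
  rcases le_total r n with hrn | hnr
  · obtain ⟨m, rfl⟩ := Nat.exists_eq_add_of_le hrn
    have hqpos : ∀ j < m, 0 < q (block x j r) (x (j + r)) := fun j _ =>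
      hq.pos_of_wordProb_pos hx j
    have hle := (sum_maxLogRatio_le hδ hqδ hqpos (zero_lt_one.trans_le ht) (hmix m)).trans
      (mul_le_mul_of_nonneg_left (add_le_add_right (mul_le_mul_of_nonneg_left
        (mixtureCost_mono δ (Nat.le_add_left m r)) (by positivity)) _) (by norm_num))
    rw [hp m x, hq m x]
    calc wordProb Q (block x 0 r) * (∏ j ∈ Finset.range m, p (block x j r) (x (j + r))) *
          wordProb P (block x 0 r)
        ≤ 1 * (ENNReal.ofReal (Real.exp (8 * (Real.log t +
          (Fintype.card A : ℝ) ^ r * mixtureCost A δ (r + m)))) *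
            ∏ j ∈ Finset.range m, q (block x j r) (x (j + r))) * wordProb P (block x 0 r) := by
          gcongr
          · exact prob_le_one
          · refine (prod_le_exp_sum_maxLogRatio_mul_prod hqpos p).trans ?_
            gcongr
      _ = _ := by ring
  · have hcost := mixtureCost_nonneg (A := A) hδ n
    have hlog := Real.log_nonneg ht
    calc wordProb Q (block x 0 n) * wordProb P (block x 0 r) ≤ 1 * wordProb P (block x 0 n) :=
          mul_le_mul' prob_le_one (wordProb_block_anti P x hnr)
      _ ≤ _ := by
          gcongr
          exact ENNReal.one_le_ofReal.2 (Real.one_le_exp (by positivity))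

theorem IsTransition.ae_exists_mixtureLikelihood_le [MeasurableSingletonClass A]
    [IsProbabilityMeasure P] (hq : IsTransition P r q) :
    ∀ᵐ ω ∂P, ∃ K : ℕ, ∀ (n : ℕ) (h : r ≤ n) (m : ℕ),
      mixtureLikelihood (fun b => q (suffix r h b)) m ω ≤ K * 2 ^ n := by
  have hweak (d : ℕ) (t : ENNReal) : t * P {ω | t <
      ⨆ m, mixtureLikelihood (fun b => q (suffix r (Nat.le_add_left r d) b)) m ω} ≤ 1 := by
    refine le_trans ?_ ((hq.of_le (Nat.le_add_left r d)).mul_measure_exists_le_mixtureLikelihood t)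
    gcongr with ω
    exact fun h => (lt_iSup_iff.1 h).imp fun _ => le_of_lt
  filter_upwards [ae_exists_forall_le_mul_two_pow hweak] with ω ⟨K, hK⟩
  refine ⟨K, fun n h m => ?_⟩
  obtain ⟨d, rfl⟩ := Nat.exists_eq_add_of_le' h
  calc _ ≤ (K : ENNReal) * 2 ^ d := (le_iSup _ m).trans (hK d)
    _ ≤ K * 2 ^ (d + r) := by
      gcongr
      · norm_num
      · omega

theorem IsTransition.ae_exists_wordProb_le [MeasurableSingletonClass A] [IsProbabilityMeasure P]
    (hq : IsTransition P r q) :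
    ∃ δ : ℝ, 0 < δ ∧ ∀ᵐ ω ∂P, ∃ D : ℝ, 0 < D ∧ ∀ n k : ℕ, r ≤ k → ∀ Q ∈ markovLaws A k,
      wordProb Q (block ω 0 n) ≤ ENNReal.ofReal (Real.exp (D * (k + 1) +
        8 * (Fintype.card A : ℝ) ^ k * mixtureCost A δ n)) * wordProb P (block ω 0 n) := by
  obtain ⟨δ, hδ, hδle⟩ := exists_pos_forall_le fun x : (Fin r → A) × A => probVec (q x.1) x.2
  obtain ⟨C, hC, hCle⟩ := hq.exists_exp_le_wordProb
  refine ⟨δ, hδ, ?_⟩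
  filter_upwards [hq.ae_exists_mixtureLikelihood_le, ae_wordProb_pos P] with ω ⟨K, hK⟩ hpos
  have hlogK : 0 ≤ Real.log (K + 1) := Real.log_nonneg (by simp)
  have hlog2 : 0 < Real.log 2 := Real.log_pos (by norm_num)
  refine ⟨C + 8 * (Real.log (K + 1) + Real.log 2), by positivity, fun n k hk Q hQ => ?_⟩
  have hlow : wordProb Q (block ω 0 n) ≤ ENNReal.ofReal (Real.exp (C * (k + 1))) *
      (wordProb Q (block ω 0 n) * wordProb P (block ω 0 k)) := by
    calc wordProb Q (block ω 0 n)
        = ENNReal.ofReal (Real.exp (C * (k + 1))) * (wordProb Q (block ω 0 n) *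
            ENNReal.ofReal (Real.exp (-(C * (k + 1))))) := by
          rw [mul_left_comm, ← ofReal_exp_add, add_neg_cancel, Real.exp_zero, ENNReal.ofReal_one,
            mul_one]
      _ ≤ _ := by gcongr; exact hCle ω hpos k hk
  have hmix (m : ℕ) : mixtureLikelihood (fun b => q (suffix r hk b)) m ω ≤
      ENNReal.ofReal ((K + 1) * 2 ^ k) := by
    refine (hK k hk m).trans ?_
    rw [ENNReal.ofReal_mul (by positivity), ENNReal.ofReal_pow (by norm_num), ENNReal.ofReal_ofNat,
      ← Nat.cast_add_one, ENNReal.ofReal_natCast]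
    gcongr
    exact K.le_succ
  have hhigh := (hq.of_le hk).wordProb_mul_le hδ (fun b a => hδle (suffix r hk b, a)) hpos
    (one_le_mul_of_one_le_of_one_le (by simp) (one_le_pow₀ (by norm_num))) hmix hQ n
  refine (hlow.trans (mul_le_mul_right hhigh _)).trans ?_
  rw [← mul_assoc, ← ofReal_exp_add, Real.log_mul (by positivity) (by positivity), Real.log_pow]
  refine mul_le_mul_left (ENNReal.ofReal_le_ofReal (Real.exp_le_exp.2 ?_)) _
  nlinarith [mul_nonneg hlogK k.cast_nonneg]

end LikelihoodRatio

/-! ### Comparison of penalized likelihoods -/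

section Comparison

variable {A : Type*} [MeasurableSpace A] {P : Measure (ℕ → A)} [IsProbabilityMeasure P]

theorem log_wordProb {n : ℕ} {x : Fin n → A} (hx : 0 < wordProb P x) :
    ENNReal.log (wordProb P x) = (Real.log (wordProb P x).toReal : ℝ) :=
  ENNReal.log_pos_real hx.ne' (measure_ne_top _ _)

theorem maxLogLik_le {k n : ℕ} {x : Fin n → A} {B : ℝ} (hx : 0 < wordProb P x)
    (h : ∀ Q ∈ markovLaws A k, wordProb Q x ≤ ENNReal.ofReal (Real.exp B) * wordProb P x) :
    maxLogLik k x ≤ ((Real.log (wordProb P x).toReal + B : ℝ) : EReal) := by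
  refine iSup₂_le fun Q hQ => (ENNReal.log_monotone (h Q hQ)).trans_eq ?_
  rw [ENNReal.log_mul_add, log_wordProb hx, ENNReal.log_ofReal_of_pos (Real.exp_pos B),
    Real.log_exp, add_comm, EReal.coe_add]

theorem le_maxLogLik {k n : ℕ} {x : Fin n → A} (hP : P ∈ markovLaws A k)
    (hx : 0 < wordProb P x) :
    ((Real.log (wordProb P x).toReal : ℝ) : EReal) ≤ maxLogLik k x :=
  log_wordProb hx ▸ le_iSup₂_of_le P hP le_rfl

theorem IsPenalizedLikelihoodEstimator.pen_le {pen : ℕ → ℕ → ℝ} {κ : ℕ → ℝ}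
    {rhat : (n : ℕ) → (Fin n → A) → ℕ} (hest : IsPenalizedLikelihoodEstimator pen κ rhat)
    {r n : ℕ} {x : Fin n → A} (hP : P ∈ markovLaws A r) (hκ : (r : ℝ) < κ n)
    (hx : 0 < wordProb P x) {B : ℝ} (h : ∀ Q ∈ markovLaws A (rhat n x),
      wordProb Q x ≤ ENNReal.ofReal (Real.exp B) * wordProb P x) :
    pen n (rhat n x) ≤ pen n r + B := by
  have hmax : maxLogLik r x - pen n r ≤ maxLogLik (rhat n x) x - pen n (rhat n x) :=
    (hest n x ((Nat.cast_nonneg r).trans_lt hκ)).2 hκ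
  have hle := (EReal.sub_le_sub (le_maxLogLik hP hx) le_rfl).trans
    (hmax.trans (EReal.sub_le_sub (maxLogLik_le hx h) le_rfl))
  rw [← EReal.coe_sub, ← EReal.coe_sub, EReal.coe_le_coe_iff] at hle
  linarith

end Comparison

/-! ### Hellinger affinities -/

section Affinity

theorem exists_forall_lt_pow {ι : Type*} [Finite ι] {f : ι → ℝ} (hf : ∀ i, f i < 1) (k : ℕ) :
    ∃ l ∈ Set.Ioo (0 : ℝ) 1, ∀ i, f i < l ^ k := by
  have hlim : Tendsto (fun l : ℝ => l ^ k) (𝓝[<] 1) (𝓝 1) :=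
    ((continuous_pow k).tendsto' 1 1 (one_pow k)).mono_left nhdsWithin_le_nhds
  have hlt : ∀ᶠ l : ℝ in 𝓝[<] 1, ∀ i, f i < l ^ k :=
    eventually_all.2 fun i => hlim.eventually (lt_mem_nhds (hf i))
  exact (Eventually.and (Ioo_mem_nhdsLT one_pos) hlt).exists

variable {A : Type*} {R : ℕ}

/-- The word of the last `R` letters after the letter `a` is appended to `u`. -/
def nextWord (u : Fin R → A) (a : A) : Fin R → A :=
  Fin.tail (Fin.snoc u a : Fin (R + 1) → A)

theorem nextWord_block (x : ℕ → A) (m : ℕ) :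
    nextWord (block x m R) (x (m + R)) = block x (m + 1) R := by
  have hsnoc : (Fin.snoc (block x m R) (x (m + R)) : Fin (R + 1) → A) = block x m (R + 1) := by
    funext i
    induction i using Fin.lastCases <;> simp [block]
  rw [nextWord, hsnoc]
  funext i
  simp [Fin.tail, block, add_assoc, add_comm 1]

variable [Fintype A]

/-- The affinity of the laws of the next `k` letters after `u` under the transition matrices `g`
and `p`. -/
def affinity (g p : (Fin R → A) → A → ℝ) : ℕ → (Fin R → A) → ℝ
  | 0, _ => 1
  | k + 1, u => ∑ a, √(g u a * p u a) * affinity g p k (nextWord u a)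

theorem affinity_nonneg (g p : (Fin R → A) → A → ℝ) (k : ℕ) (u : Fin R → A) :
    0 ≤ affinity g p k u := by
  induction k generalizing u with
  | zero => exact zero_le_one
  | succ k ih => exact Finset.sum_nonneg fun a _ => mul_nonneg (Real.sqrt_nonneg _) (ih _)

theorem continuous_affinity {X : Type*} [TopologicalSpace X] {g : X → (Fin R → A) → A → ℝ}
    (hg : ∀ u a, Continuous fun x => g x u a) (p : (Fin R → A) → A → ℝ) (k : ℕ)
    (u : Fin R → A) : Continuous fun x => affinity (g x) p k u := by
  induction k generalizing u with
  | zero => exact continuous_const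
  | succ k ih =>
    exact continuous_finsetSum _ fun a _ => ((hg u a).mul continuous_const).sqrt.mul (ih _)

theorem sum_sqrt_mul_eq {x y : A → ℝ} (hx : x ∈ stdSimplex ℝ A) (hy : y ∈ stdSimplex ℝ A) :
    ∑ a, √(x a * y a) = 1 - (∑ a, (√(x a) - √(y a)) ^ 2) / 2 := by
  have hsq (a : A) : √(x a * y a) = (x a + y a - (√(x a) - √(y a)) ^ 2) / 2 := by
    rw [Real.sqrt_mul (hx.1 a), sub_sq, Real.sq_sqrt (hx.1 a), Real.sq_sqrt (hy.1 a)]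
    ring
  simp only [hsq]
  rw [← Finset.sum_div, Finset.sum_sub_distrib, Finset.sum_add_distrib, hx.2, hy.2]
  ring

theorem sum_sqrt_mul_le_one {x y : A → ℝ} (hx : x ∈ stdSimplex ℝ A) (hy : y ∈ stdSimplex ℝ A) :
    ∑ a, √(x a * y a) ≤ 1 := by
  rw [sum_sqrt_mul_eq hx hy]
  exact sub_le_self _ (by positivity)

theorem sum_sqrt_mul_lt_one {x y : A → ℝ} (hx : x ∈ stdSimplex ℝ A) (hy : y ∈ stdSimplex ℝ A)
    (hxy : x ≠ y) : ∑ a, √(x a * y a) < 1 := by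
  obtain ⟨c, hc⟩ := Function.ne_iff.1 hxy
  have hpos : 0 < ∑ a, (√(x a) - √(y a)) ^ 2 :=
    Finset.sum_pos' (fun a _ => sq_nonneg _) ⟨c, Finset.mem_univ c,
      sq_pos_of_ne_zero (sub_ne_zero.2 fun h => hc ((Real.sqrt_inj (hx.1 c) (hy.1 c)).1 h))⟩
  rw [sum_sqrt_mul_eq hx hy]
  linarith

variable {g p : (Fin R → A) → A → ℝ}

theorem affinity_le_one (hg : ∀ u, g u ∈ stdSimplex ℝ A) (hp : ∀ u, p u ∈ stdSimplex ℝ A) (k : ℕ)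
    (u : Fin R → A) : affinity g p k u ≤ 1 := by
  induction k generalizing u with
  | zero => exact le_rfl
  | succ k ih =>
    exact (Finset.sum_le_sum fun a _ => mul_le_of_le_one_right (Real.sqrt_nonneg _) (ih _)).trans
      (sum_sqrt_mul_le_one (hg u) (hp u))

theorem affinity_succ_lt_one (hg : ∀ u, g u ∈ stdSimplex ℝ A) (hp : ∀ u, p u ∈ stdSimplex ℝ A)
    (k : ℕ) {u : Fin R → A} (hne : g u ≠ p u) : affinity g p (k + 1) u < 1 :=
  (Finset.sum_le_sum fun _ _ => mul_le_of_le_one_right (Real.sqrt_nonneg _)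
    (affinity_le_one hg hp k _)).trans_lt (sum_sqrt_mul_lt_one (hg u) (hp u) hne)

theorem affinity_lt_one (hg : ∀ u, g u ∈ stdSimplex ℝ A) (hp : ∀ u, p u ∈ stdSimplex ℝ A)
    {x : ℕ → A} (hx : ∀ j, 0 < p (block x j R) (x (j + R))) {i j k : ℕ} (hik : i < k)
    (hne : g (block x (j + i) R) ≠ p (block x (j + i) R)) :
    affinity g p k (block x j R) < 1 := by
  obtain ⟨k, rfl⟩ := Nat.exists_eq_add_one_of_ne_zero hik.ne_bot
  induction i generalizing j k with
  | zero => exact affinity_succ_lt_one hg hp k hne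
  | succ i ih =>
    by_cases hj : g (block x j R) = p (block x j R)
    · obtain ⟨k, rfl⟩ : ∃ l, k = l + 1 := Nat.exists_eq_add_one_of_ne_zero (by omega)
      have hnext : affinity g p (k + 1) (nextWord (block x j R) (x (j + R))) < 1 := by
        rw [nextWord_block]
        exact ih (by rwa [show j + 1 + i = j + (i + 1) by omega]) k (by omega)
      rw [← (hp (block x j R)).2, affinity]
      simp only [hj, Real.sqrt_mul_self ((hp _).1 _)]
      exact Finset.sum_lt_sum
        (fun a _ => mul_le_of_le_one_right ((hp _).1 _) (affinity_le_one hg hp _ _))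
        ⟨x (j + R), Finset.mem_univ _, mul_lt_of_lt_one_right (hx j) hnext⟩
    · exact affinity_succ_lt_one hg hp k hj

/-- Geometric weights on the affinities of the first `k` steps turn a contraction over `k` steps
into a contraction at every step. -/
theorem exists_lyapunov {k : ℕ} (hk : 0 < k) {S : Set (Fin R → A)}
    (hS : ∀ u ∈ S, affinity g p k u < 1) :
    ∃ l ∈ Set.Ioo (0 : ℝ) 1, ∃ ψ : (Fin R → A) → ℝ, (∀ u, 1 ≤ ψ u) ∧
      ∀ u ∈ S, ∑ a, √(g u a * p u a) * ψ (nextWord u a) ≤ l * ψ u := by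
  obtain ⟨l, hl, hlt⟩ := exists_forall_lt_pow (fun u : S => hS u u.2) k
  have hl0 := hl.1
  let ψ (u : Fin R → A) : ℝ := ∑ j ∈ Finset.range k, l⁻¹ ^ j * affinity g p j u
  refine ⟨l, hl, ψ, fun u => ?_, fun u hu => ?_⟩
  · calc (1 : ℝ) = l⁻¹ ^ 0 * affinity g p 0 u := by rw [affinity, pow_zero, one_mul]
      _ ≤ ψ u := Finset.single_le_sum (f := fun j => l⁻¹ ^ j * affinity g p j u)
        (fun j _ => mul_nonneg (by positivity) (affinity_nonneg g p j u)) (Finset.mem_range.2 hk)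
  · have hshift : ∑ a, √(g u a * p u a) * ψ (nextWord u a) =
        l * ∑ j ∈ Finset.range k, l⁻¹ ^ (j + 1) * affinity g p (j + 1) u := by
      simp only [ψ, affinity, Finset.mul_sum]
      rw [Finset.sum_comm]
      refine Finset.sum_congr rfl fun j _ => Finset.sum_congr rfl fun a _ => ?_
      rw [pow_succ]
      field_simp
    have hlast : l⁻¹ ^ k * affinity g p k u ≤ 1 := by
      rw [inv_pow, inv_mul_le_iff₀ (by positivity), mul_one]
      exact (hlt ⟨u, hu⟩).le
    have htelescope : ∑ j ∈ Finset.range k, l⁻¹ ^ (j + 1) * affinity g p (j + 1) u + 1 =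
        ψ u + l⁻¹ ^ k * affinity g p k u := by
      rw [← Finset.sum_range_succ, Finset.sum_range_succ', pow_zero, one_mul, affinity]
    rw [hshift]
    gcongr
    linarith

end Affinity

/-! ### Exponential decay of likelihood ratios -/

section Decay

variable {A : Type*} {R : ℕ} {g : (Fin R → A) → A → ℝ} {p : (Fin R → A) → PMF A}

/-- The square root of the likelihood ratio of `m` letters under the transition weights `g`, which
need not be probabilities, and under the transition probabilities `p`. -/
def rootRatio (g : (Fin R → A) → A → ℝ) (p : (Fin R → A) → PMF A) (m : ℕ) (ω : ℕ → A) :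
    ENNReal :=
  ∏ j ∈ Finset.range m, ENNReal.ofReal
    √(g (block ω j R) (ω (j + R)) / probVec (p (block ω j R)) (ω (j + R)))

theorem rootRatio_factorsThrough (g : (Fin R → A) → A → ℝ) (p : (Fin R → A) → PMF A) (m : ℕ) :
    (rootRatio g p m).FactorsThrough fun ω => block ω 0 (m + R) := by
  intro x y hxy
  have h := block_zero_eq_iff.1 hxy
  refine Finset.prod_congr rfl fun j hj => ?_
  rw [Finset.mem_range] at hj
  rw [h (j + R) (by omega), block_congr (y := y) fun i hi => h i (by omega)]

theorem mul_rootRatio_succ_update (m : ℕ) (ω : ℕ → A) (a : A) :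
    p (block ω m R) a * rootRatio g p (m + 1) (Function.update ω (m + R) a) =
      rootRatio g p m ω * ENNReal.ofReal √(g (block ω m R) a * probVec (p (block ω m R)) a) := by
  have hpast : rootRatio g p m (Function.update ω (m + R) a) = rootRatio g p m ω :=
    rootRatio_factorsThrough g p m (block_update (by simp) a)
  have hp : 0 ≤ probVec (p (block ω m R)) a := ENNReal.toReal_nonneg
  have hroot : √(g (block ω m R) a * probVec (p (block ω m R)) a) =
      probVec (p (block ω m R)) a * √(g (block ω m R) a / probVec (p (block ω m R)) a) := by
    rcases hp.eq_or_lt with h0 | h0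
    · simp [← h0]
    · rw [Real.sqrt_mul' _ hp, Real.sqrt_div' _ hp]
      field_simp
      rw [Real.sq_sqrt hp]
  rw [rootRatio, Finset.prod_range_succ, ← rootRatio, hpast, block_update le_rfl,
    Function.update_self, hroot, ENNReal.ofReal_mul hp, ofReal_probVec]
  ring

variable [MeasurableSpace A] [MeasurableSingletonClass A] {P : Measure (ℕ → A)}

theorem IsStationary.measure_block_eq [Finite A] (hP : IsStationary P) (m : ℕ) {n : ℕ}
    (x : Fin n → A) : P {ω | block ω m n = x} = wordProb P x := by
  induction m with
  | zero => rfl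
  | succ m ih =>
    have hshift (ω : ℕ → A) : block ω (m + 1) n = block (fun k => ω (k + 1)) m n :=
      funext fun i => congrArg ω (by omega)
    have hmeas : MeasurableSet {ω : ℕ → A | block ω m n = x} :=
      (measurableSet_singleton x).preimage (measurable_block m n)
    rw [← ih, ← hP.measure_preimage hmeas.nullMeasurableSet]
    simp only [hshift, Set.preimage_ofPred_eq]

theorem IsStationary.ae_wordProb_block_pos [Finite A] (hP : IsStationary P) (n : ℕ) :
    ∀ᵐ ω ∂P, ∀ m, 0 < wordProb P (block ω m n) :=
  ae_all_iff.2 fun m =>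
    (ae_measure_preimage_singleton_ne_zero P fun ω => block ω m n).mono fun ω hω =>
      pos_iff_ne_zero.2 (by rwa [← hP.measure_block_eq m])

variable [Fintype A]

theorem IsTransition.lintegral_rootRatio_le (hp : IsTransition P R p) (hst : IsStationary P)
    {l : ℝ} (hl : 0 ≤ l) {ψ : (Fin R → A) → ℝ} (hψ : ∀ u, 0 ≤ ψ u)
    (h : ∀ u, 0 < wordProb P u →
      ∑ a, √(g u a * probVec (p u) a) * ψ (nextWord u a) ≤ l * ψ u) (m : ℕ) :
    ∫⁻ ω, rootRatio g p m ω * ENNReal.ofReal (ψ (block ω m R)) ∂P ≤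
      ENNReal.ofReal l ^ m * ∫⁻ ω, ENNReal.ofReal (ψ (block ω 0 R)) ∂P := by
  induction m with
  | zero => simp [rootRatio]
  | succ m ih =>
    have hF : (fun ω => rootRatio g p (m + 1) ω * ENNReal.ofReal (ψ (block ω (m + 1) R)))
        |>.FactorsThrough fun ω => block ω 0 (m + R + 1) := by
      intro x y hxy
      have hroot : rootRatio g p (m + 1) x = rootRatio g p (m + 1) y :=
        rootRatio_factorsThrough g p (m + 1) (by rwa [add_right_comm])
      have hblock : block x (m + 1) R = block y (m + 1) R :=
        block_congr fun i hi => block_zero_eq_iff.1 hxy i (by omega)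
      simp only [hroot, hblock]
    have hnext (ω : ℕ → A) (a : A) :
        block (Function.update ω (m + R) a) (m + 1) R = nextWord (block ω m R) a := by
      rw [← nextWord_block, block_update le_rfl, Function.update_self]
    have hstep : ∀ᵐ ω ∂P, ∑ a, p (block ω m R) a *
        (rootRatio g p (m + 1) (Function.update ω (m + R) a) *
          ENNReal.ofReal (ψ (block (Function.update ω (m + R) a) (m + 1) R))) ≤
        ENNReal.ofReal l * (rootRatio g p m ω * ENNReal.ofReal (ψ (block ω m R))) := by
      filter_upwards [hst.ae_wordProb_block_pos R] with ω hω
      simp only [← mul_assoc, mul_rootRatio_succ_update, hnext]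
      simp only [mul_assoc, ← ENNReal.ofReal_mul (Real.sqrt_nonneg _)]
      rw [← Finset.mul_sum, mul_left_comm, ← ENNReal.ofReal_mul hl,
        ← ENNReal.ofReal_sum_of_nonneg fun a _ => mul_nonneg (Real.sqrt_nonneg _) (hψ _)]
      gcongr
      exact h _ (hω m)
    rw [hp.lintegral_eq hF, pow_succ', mul_assoc]
    refine (lintegral_mono_ae hstep).trans ?_
    rw [lintegral_const_mul' _ _ ENNReal.ofReal_ne_top]
    gcongr

theorem IsTransition.ae_rootRatio_le [IsFiniteMeasure P] (hp : IsTransition P R p)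
    (hst : IsStationary P) {k : ℕ} (hk : 0 < k)
    (hg : ∀ u, 0 < wordProb P u → affinity g (fun u => probVec (p u)) k u < 1) :
    ∃ l ∈ Set.Ioo (0 : ℝ) 1, ∀ᵐ ω ∂P, ∀ᶠ m in atTop,
      rootRatio g p m ω ≤ ENNReal.ofReal l ^ m := by
  obtain ⟨l, hl, ψ, hψ, hlψ⟩ := exists_lyapunov hk (S := {u | 0 < wordProb P u}) hg
  obtain ⟨b, hlb, hb1⟩ := exists_between hl.2
  have hψ0 (u) : 0 ≤ ψ u := zero_le_one.trans (hψ u)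
  refine ⟨b, ⟨hl.1.trans hlb, hb1⟩, ae_eventually_le_pow_of_lintegral_le
    (c := ∫⁻ ω, ENNReal.ofReal (ψ (block ω 0 R)) ∂P) ENNReal.ofReal_ne_top
    ((ENNReal.ofReal_lt_ofReal_iff (hl.1.trans hlb)).2 hlb) ?_
    (fun m => measurable_of_factorsThrough_block (rootRatio_factorsThrough g p m)) fun m => ?_⟩
  · rw [lintegral_comp_block P fun u => ENNReal.ofReal (ψ u)]
    exact ENNReal.sum_ne_top.2 fun u _ =>
      ENNReal.mul_ne_top ENNReal.ofReal_ne_top (measure_ne_top _ _)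
  · refine (lintegral_mono fun ω => le_mul_of_one_le_right zero_le ?_).trans
      (hp.lintegral_rootRatio_le hst hl.1.le hψ0 hlψ m)
    exact ENNReal.one_le_ofReal.2 (hψ _)

end Decay

/-! ### Underestimation of the order -/

section Underestimation

theorem exists_finset_forall_le_of_isCompact {ι κ : Type*} [Finite ι] [Finite κ]
    {K U : Set (ι → κ → ℝ)} (hK : IsCompact K) (hU : IsOpen U) (hKU : K ⊆ U) :
    ∃ G : Finset (ι → κ → ℝ), ↑G ⊆ U ∧ ∀ x ∈ K, ∃ g ∈ G, ∀ i j, x i j ≤ g i j := by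
  classical
  refine hK.induction_on (p := fun s => ∃ G : Finset (ι → κ → ℝ), ↑G ⊆ U ∧
    ∀ x ∈ s, ∃ g ∈ G, ∀ i j, x i j ≤ g i j) ⟨∅, by simp⟩ ?_ ?_ fun x hx => ?_
  · exact fun s t hst ⟨G, hG, h⟩ => ⟨G, hG, fun x hx => h x (hst hx)⟩
  · rintro s t ⟨G, hG, hs⟩ ⟨H, hH, ht⟩
    refine ⟨G ∪ H, by simp [hG, hH], ?_⟩
    rintro x (hx | hx)
    · exact (hs x hx).imp fun g hg => ⟨Finset.mem_union_left H hg.1, hg.2⟩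
    · exact (ht x hx).imp fun g hg => ⟨Finset.mem_union_right G hg.1, hg.2⟩
  · have hcont : Continuous fun δ : ℝ => fun i j => x i j + δ := by fun_prop
    have hlim : ∀ᶠ δ in 𝓝 (0 : ℝ), (fun i j => x i j + δ) ∈ U :=
      hcont.continuousAt.eventually (hU.mem_nhds (by simpa using hKU hx))
    obtain ⟨δ, hδ, hδ0⟩ :=
      ((hlim.filter_mono nhdsWithin_le_nhds).and (self_mem_nhdsWithin (s := Set.Ioi 0))).exists
    have hmem : ∀ᶠ y in 𝓝 x, ∀ i j, y i j < x i j + δ :=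
      eventually_all.2 fun i => eventually_all.2 fun j =>
        (continuous_apply_apply i j).continuousAt.eventually
          (gt_mem_nhds (lt_add_of_pos_right (x i j) hδ0))
    exact ⟨_, mem_nhdsWithin_of_mem_nhds hmem, {fun i j => x i j + δ}, by simpa using hδ,
      fun y hy => ⟨_, Finset.mem_singleton_self _, fun i j => (hy i j).le⟩⟩

variable {A : Type*} {R r : ℕ} {g : (Fin R → A) → A → ℝ} {p : (Fin R → A) → PMF A}

theorem prod_le_rootRatio_sq_mul_prod {q : (Fin R → A) → PMF A}
    (hqg : ∀ u a, probVec (q u) a ≤ g u a) {x : ℕ → A}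
    (hx : ∀ j, 0 < p (block x j R) (x (j + R))) (m : ℕ) :
    ∏ j ∈ Finset.range m, q (block x j R) (x (j + R)) ≤
      rootRatio g p m x ^ 2 * ∏ j ∈ Finset.range m, p (block x j R) (x (j + R)) := by
  rw [rootRatio, ← Finset.prod_pow, ← Finset.prod_mul_distrib]
  refine Finset.prod_le_prod' fun j _ => ?_
  have hp := probVec_pos_iff.2 (hx j)
  have hg : 0 ≤ g (block x j R) (x (j + R)) := ENNReal.toReal_nonneg.trans (hqg _ _)
  rw [← ofReal_probVec (p _), ← ENNReal.ofReal_pow (Real.sqrt_nonneg _),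
    Real.sq_sqrt (div_nonneg hg hp.le), ← ENNReal.ofReal_mul (div_nonneg hg hp.le),
    div_mul_cancel₀ _ hp.ne', ← ofReal_probVec]
  exact ENNReal.ofReal_le_ofReal (hqg _ _)

variable [MeasurableSpace A] [MeasurableSingletonClass A] {P : Measure (ℕ → A)}

/-- By stationarity a word may be placed after `R` further letters, where the transition
probabilities of order `R` apply to all of its letters. -/
theorem IsTransition.of_eq_suffix [Finite A] (hp : IsTransition P R p) (hst : IsStationary P)
    (hr : r ≤ R) {q : (Fin r → A) → PMF A} (h : ∀ u, 0 < wordProb P u → q (suffix r hr u) = p u) :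
    IsTransition P r q := by
  refine isTransition_of_succ fun m x => ?_
  let E : Set (ℕ → A) := {ω | block ω R (m + r) = block x 0 (m + r)}
  have hE : MeasurableSet E :=
    (measurableSet_singleton _).preimage (measurable_block R (m + r))
  have hE_past : MeasurableSet[blockFiltration A (m + r + R)] E := by
    have : Nonempty (Fin (m + r) → A) := ⟨block x 0 (m + r)⟩
    have hF : (fun ω : ℕ → A => block ω R (m + r)).FactorsThrough
        fun ω => block ω 0 (m + r + R) :=
      fun y z hyz => block_congr fun i hi => block_zero_eq_iff.1 hyz i (by omega)
    exact measurable_blockFiltration hF (measurableSet_singleton (block x 0 (m + r)))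
  have hsplit : {ω : ℕ → A | block ω R (m + r + 1) = block x 0 (m + r + 1)} =
      E ∩ {ω | ω (m + r + R) = x (m + r)} := by
    have hblock (ω : ℕ → A) (n : ℕ) : block ω R n = block (fun i => ω (i + R)) 0 n := by
      funext i
      simp [block, add_comm]
    ext ω
    simp only [E, Set.mem_ofPred_eq, Set.mem_inter_iff, hblock, block_zero_succ_eq_iff]
  have hsuffix : ∀ ω ∈ E, suffix r hr (block ω (m + r) R) = block x m r := by
    intro ω hω
    rw [suffix_block]
    funext i
    calc ω (m + r + (R - r) + i) = block ω R (m + r) ⟨m + i, by omega⟩ :=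
          congrArg ω (by dsimp only; omega)
      _ = block x 0 (m + r) ⟨m + i, by omega⟩ := congrFun hω _
      _ = x (m + i) := congrArg x (zero_add _)
  rw [← hst.measure_block_eq R, ← hst.measure_block_eq R, hsplit,
    hp.measure_inter_eq_lintegral hE_past, mul_comm, ← setLIntegral_const]
  refine setLIntegral_congr_fun_ae hE ?_
  filter_upwards [hst.ae_wordProb_block_pos R] with ω hω hωE
  rw [← h _ (hω _), hsuffix ω hωE]

section Brackets

variable [Fintype A]

theorem IsTransition.exists_ne_probVec [IsProbabilityMeasure P] (hp : IsTransition P R p)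
    (hst : IsStationary P) (hr : r ≤ R) (hnot : P ∉ markovLaws A r) {g : (Fin r → A) → A → ℝ}
    (hg : ∀ b, g b ∈ stdSimplex ℝ A) :
    ∃ v, 0 < wordProb P v ∧ g (suffix r hr v) ≠ probVec (p v) := by
  by_contra! hall
  have hsum (b) : ∑ a, ENNReal.ofReal (g b a) = 1 := by
    rw [← ENNReal.ofReal_sum_of_nonneg fun a _ => (hg b).1 a, (hg b).2, ENNReal.ofReal_one]
  have hq : IsTransition P r fun b => PMF.ofFintype (fun a => ENNReal.ofReal (g b a)) (hsum b) := by
    refine hp.of_eq_suffix hst hr fun v hv => ?_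
    ext a
    rw [PMF.ofFintype_apply, hall v hv, ofReal_probVec]
  exact hnot (mem_markovLaws_iff.2 ⟨inferInstance, _, hq⟩)

theorem IsTransition.exists_affinity_lt_one [IsProbabilityMeasure P] (hp : IsTransition P R p)
    (hst : IsStationary P) (hirr : IsIrreducible P R) (hr : r ≤ R) (hnot : P ∉ markovLaws A r) :
    ∃ k, 0 < k ∧ ∀ g : (Fin r → A) → A → ℝ, (∀ b, g b ∈ stdSimplex ℝ A) →
      ∀ u, 0 < wordProb P u →
        affinity (fun u => g (suffix r hr u)) (fun u => probVec (p u)) k u < 1 := by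
  choose! M hM using hirr
  obtain ⟨k, hk⟩ := Finite.bddAbove_range fun w : (Fin R → A) × (Fin R → A) => M w.1 w.2
  refine ⟨k + 1, k.succ_pos, fun g hg u hu => ?_⟩
  obtain ⟨v, hv, hne⟩ := hp.exists_ne_probVec hst hr hnot hg
  obtain ⟨ω, ⟨rfl, hωv⟩, hω⟩ := Measure.exists_mem_of_measure_ne_zero_of_ae (hM u v hu hv).ne'
    (ae_restrict_of_ae (ae_wordProb_pos P))
  refine affinity_lt_one (fun u => hg _) (fun u => probVec_mem_stdSimplex _)
    (fun j => probVec_pos_iff.2 (hp.pos_of_wordProb_pos hω j))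
    (Nat.lt_succ_of_le (hk ⟨(block ω 0 R, v), rfl⟩)) ?_
  rwa [zero_add, hωv]

theorem IsTransition.exists_brackets [IsProbabilityMeasure P] (hp : IsTransition P R p)
    (hst : IsStationary P) (hirr : IsIrreducible P R) (hr : r ≤ R) (hnot : P ∉ markovLaws A r) :
    ∃ k, 0 < k ∧ ∃ G : Finset ((Fin r → A) → A → ℝ),
      (∀ g ∈ G, ∀ u, 0 < wordProb P u →
        affinity (fun u => g (suffix r hr u)) (fun u => probVec (p u)) k u < 1) ∧
      ∀ q : (Fin r → A) → PMF A, ∃ g ∈ G, ∀ b a, probVec (q b) a ≤ g b a := by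
  obtain ⟨k, hk, haff⟩ := hp.exists_affinity_lt_one hst hirr hr hnot
  let U : Set ((Fin r → A) → A → ℝ) := {g | ∀ u, 0 < wordProb P u →
    affinity (fun u => g (suffix r hr u)) (fun u => probVec (p u)) k u < 1}
  have hU : IsOpen U := by
    refine isOpen_iff_eventually.2 fun g hg => eventually_all.2 fun u =>
      eventually_imp_distrib_left.2 fun hu => ?_
    exact (continuous_affinity (fun u a => continuous_apply_apply (suffix r hr u) a) _ k
      u).continuousAt.eventually (gt_mem_nhds (hg u hu))
  have hK : IsCompact (Set.univ.pi fun _ : Fin r → A => stdSimplex ℝ A) :=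
    isCompact_univ_pi fun _ => isCompact_stdSimplex ℝ A
  obtain ⟨G, hG, hle⟩ := exists_finset_forall_le_of_isCompact hK hU fun g hg =>
    haff g fun b => hg b (Set.mem_univ b)
  exact ⟨k, hk, G, fun g hg => hG hg, fun q => hle _ fun b _ => probVec_mem_stdSimplex (q b)⟩

end Brackets

theorem IsTransition.ae_prod_le_pow_mul_prod [Finite A] [IsProbabilityMeasure P]
    (hp : IsTransition P R p) (hst : IsStationary P) (hirr : IsIrreducible P R) (hr : r ≤ R)
    (hnot : P ∉ markovLaws A r) :
    ∃ l ∈ Set.Ioo (0 : ℝ) 1, ∀ᵐ ω ∂P, ∀ᶠ m in atTop, ∀ q : (Fin r → A) → PMF A,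
      ∏ j ∈ Finset.range m, q (suffix r hr (block ω j R)) (ω (j + R)) ≤
        ENNReal.ofReal (l ^ m) * ∏ j ∈ Finset.range m, p (block ω j R) (ω (j + R)) := by
  have := Fintype.ofFinite A
  obtain ⟨k, hk, G, hG, hbr⟩ := hp.exists_brackets hst hirr hr hnot
  choose l hl hdecay using fun g : G => hp.ae_rootRatio_le hst hk (hG g g.2)
  obtain ⟨L, hL, hlt⟩ := exists_forall_lt_pow (fun g => (hl g).2) 1
  simp only [pow_one] at hlt
  refine ⟨L ^ 2, ⟨pow_pos hL.1 2, pow_lt_one₀ hL.1.le hL.2 two_ne_zero⟩, ?_⟩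
  filter_upwards [ae_all_iff.2 hdecay, ae_wordProb_pos P] with ω hω hpos
  filter_upwards [eventually_all.2 hω] with m hm q
  obtain ⟨g, hg, hqg⟩ := hbr q
  calc ∏ j ∈ Finset.range m, q (suffix r hr (block ω j R)) (ω (j + R))
      ≤ rootRatio (fun u => g (suffix r hr u)) p m ω ^ 2 *
          ∏ j ∈ Finset.range m, p (block ω j R) (ω (j + R)) :=
        prod_le_rootRatio_sq_mul_prod (q := fun u => q (suffix r hr u)) (fun u a => hqg _ a)
          (hp.pos_of_wordProb_pos hpos) m
    _ ≤ (ENNReal.ofReal L ^ m) ^ 2 * ∏ j ∈ Finset.range m, p (block ω j R) (ω (j + R)) := by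
        gcongr
        refine (hm ⟨g, hg⟩).trans ?_
        gcongr
        exact (hlt _).le
    _ = _ := by rw [← ENNReal.ofReal_pow hL.1.le, ← ENNReal.ofReal_pow (pow_pos hL.1 m).le,
        pow_right_comm]

theorem IsTransition.ae_wordProb_le_exp [Finite A] [IsProbabilityMeasure P]
    (hp : IsTransition P R p) (hst : IsStationary P) (hirr : IsIrreducible P R) (hr : r ≤ R)
    (hnot : P ∉ markovLaws A r) :
    ∃ c : ℝ, 0 < c ∧ ∀ᵐ ω ∂P, ∃ D : ℝ, ∀ᶠ n : ℕ in atTop, ∀ Q ∈ markovLaws A r,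
      wordProb Q (block ω 0 n) ≤
        ENNReal.ofReal (Real.exp (D - c * n)) * wordProb P (block ω 0 n) := by
  obtain ⟨l, ⟨hl0, hl1⟩, hdecay⟩ := hp.ae_prod_le_pow_mul_prod hst hirr hr hnot
  refine ⟨-Real.log l, neg_pos.2 (Real.log_neg hl0 hl1), ?_⟩
  filter_upwards [hdecay, ae_wordProb_pos P] with ω hω hpos
  let π := (wordProb P (block ω 0 R)).toReal
  have hπ0 : 0 < π := ENNReal.toReal_pos (hpos R).ne' (measure_ne_top _ _)
  have hπ : ENNReal.ofReal π = wordProb P (block ω 0 R) :=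
    ENNReal.ofReal_toReal (measure_ne_top _ _)
  refine ⟨-Real.log l * R - Real.log π, ?_⟩
  filter_upwards [(tendsto_sub_atTop_nat R).eventually hω, eventually_ge_atTop R]
    with n hn hRn Q hQ
  obtain ⟨m, rfl⟩ := Nat.exists_eq_add_of_le hRn
  rw [Nat.add_sub_cancel_left] at hn
  obtain ⟨_, q, hq⟩ := mem_markovLaws_iff.1 hQ
  have hconst : Real.exp (-Real.log l * R - Real.log π - -Real.log l * ↑(R + m)) * π = l ^ m := by
    rw [show -Real.log l * R - Real.log π - -Real.log l * ↑(R + m) = m * Real.log l - Real.log π by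
      push_cast; ring, Real.exp_sub, Real.exp_log hπ0, Real.exp_nat_mul, Real.exp_log hl0,
      div_mul_cancel₀ _ hπ0.ne']
  rw [hq.of_le hr m ω, hp m ω, ← hπ, ← mul_assoc, ← ENNReal.ofReal_mul (Real.exp_pos _).le, hconst]
  exact (mul_le_of_le_one_left' prob_le_one).trans (hn q)

end Underestimation

/-! ### Growth of the penalty -/

section Penalty

theorem tendsto_log_natCast : Tendsto (fun n : ℕ => Real.log n) atTop atTop :=
  Real.tendsto_log_atTop.comp tendsto_natCast_atTop_atTop

theorem tendsto_log_log_natCast : Tendsto (fun n : ℕ => Real.log (Real.log n)) atTop atTop :=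
  Real.tendsto_log_atTop.comp tendsto_log_natCast

theorem eventually_mixtureCost_le (A : Type*) [Fintype A] (δ : ℝ) :
    ∃ C : ℝ, ∀ᶠ n : ℕ in atTop, mixtureCost A δ n ≤ C + 2 * Real.log (Real.log n) := by
  refine ⟨Fintype.card A * Real.log (1 + 2 / δ) + 2 * Real.log 4, ?_⟩
  filter_upwards [tendsto_log_natCast.eventually_ge_atTop 2] with n hn
  have hlog2 : (1 : ℝ) / 2 < Real.log 2 := by linarith [Real.log_two_gt_d9]
  have hnatLog : (Nat.log 2 n : ℝ) ≤ 2 * Real.log n := by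
    refine (Real.natLog_le_logb n 2).trans ?_
    rw [Real.logb, Nat.cast_ofNat, div_le_iff₀ (by positivity)]
    nlinarith
  have hloglog : Real.log (Nat.log 2 n + 2) ≤ Real.log 4 + Real.log (Real.log n) := by
    rw [← Real.log_mul (by norm_num) (by positivity)]
    gcongr
    linarith
  rw [mixtureCost]
  linarith

variable {f : ℕ → ℝ}

theorem eventually_overestimation_cost_lt (hf : ∀ᶠ n in atTop, 33 ≤ f n) (A : Type*) [Fintype A]
    [Nontrivial A] (r : ℕ) (δ : ℝ) {D : ℝ} (hD : 0 < D) :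
    ∀ᶠ n : ℕ in atTop, ∀ k, r < k →
      (Fintype.card A : ℝ) ^ r * f n * Real.log (Real.log n) +
        (D * (k + 1) + 8 * (Fintype.card A : ℝ) ^ k * mixtureCost A δ n) <
      (Fintype.card A : ℝ) ^ k * f n * Real.log (Real.log n) := by
  obtain ⟨C, hC⟩ := eventually_mixtureCost_le A δ
  filter_upwards [hf, hC, tendsto_log_log_natCast.eventually_gt_atTop (2 * (D + 8 * C)),
    tendsto_log_log_natCast.eventually_gt_atTop 0] with n hfn hcost hL hL0 k hk
  set L := Real.log (Real.log n)
  set X := (Fintype.card A : ℝ) ^ k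
  have hcard : (2 : ℝ) ≤ Fintype.card A := by exact_mod_cast Fintype.one_lt_card (α := A)
  have hrX : (Fintype.card A : ℝ) ^ r ≤ X / 2 := by
    rw [le_div_iff₀ two_pos]
    calc (Fintype.card A : ℝ) ^ r * 2 ≤ (Fintype.card A : ℝ) ^ r * Fintype.card A := by gcongr
      _ = (Fintype.card A : ℝ) ^ (r + 1) := (pow_succ _ _).symm
      _ ≤ X := pow_le_pow_right₀ (by linarith) hk
  have hkX : (k : ℝ) + 1 ≤ X :=
    calc (k : ℝ) + 1 ≤ 2 ^ k := by exact_mod_cast Nat.lt_two_pow_self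
      _ ≤ X := pow_le_pow_left₀ zero_le_two hcard k
  calc (Fintype.card A : ℝ) ^ r * f n * L + (D * (k + 1) + 8 * X * mixtureCost A δ n)
      ≤ X / 2 * f n * L + (D * X + 8 * X * (C + 2 * L)) := by gcongr
    _ = X * (f n / 2 * L + 16 * L + (D + 8 * C)) := by ring
    _ < X * (f n * L) := by
        have : 33 * L ≤ f n * L := by gcongr
        gcongr
        linarith
    _ = X * f n * L := (mul_assoc _ _ _).symm

theorem eventually_underestimation_gain_lt (hf : ∀ᶠ n in atTop, 33 ≤ f n)
    (hf0 : Tendsto (fun n : ℕ => f n * Real.log (Real.log n) / n) atTop (𝓝 0)) {a : ℝ} (ha : 0 < a)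
    (r k : ℕ) (D : ℝ) {c : ℝ} (hc : 0 < c) :
    ∀ᶠ n : ℕ in atTop, a ^ r * f n * Real.log (Real.log n) + (D - c * n) <
      a ^ k * f n * Real.log (Real.log n) := by
  have hlim : Tendsto (fun n : ℕ => a ^ r * (f n * Real.log (Real.log n) / n) + D / n)
      atTop (𝓝 0) := by
    simpa using (hf0.const_mul (a ^ r)).add (tendsto_const_div_atTop_nhds_zero_nat D)
  filter_upwards [hf, hlim.eventually (gt_mem_nhds hc),
    tendsto_log_log_natCast.eventually_gt_atTop 0, eventually_gt_atTop 0] with n hfn hn hL hn0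
  have hn0' : (0 : ℝ) < n := Nat.cast_pos.2 hn0
  have hpen : 0 ≤ a ^ k * f n * Real.log (Real.log n) := by positivity
  rw [mul_div_assoc', ← add_div, div_lt_iff₀ hn0'] at hn
  linarith

end Penalty

/-! ### Consistency -/

section Consistency

variable {A : Type*} [Fintype A] [Nontrivial A] [MeasurableSpace A] [MeasurableSingletonClass A]
  {P : Measure (ℕ → A)} {r : ℕ} {pen : ℕ → ℕ → ℝ} {κ f : ℕ → ℝ}
  {rhat : (n : ℕ) → (Fin n → A) → ℕ}

theorem HasOrder.ae_eventually_ge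
    (hpen : ∀ᶠ n : ℕ in atTop, ∀ k : ℕ,
      pen n k = (Fintype.card A : ℝ) ^ k * f n * Real.log (Real.log n))
    (hκ : ∀ᶠ n in atTop, (r : ℝ) < κ n) (hf : ∀ᶠ n in atTop, 33 ≤ f n)
    (hest : IsPenalizedLikelihoodEstimator pen κ rhat) (hord : HasOrder P r)
    (hst : IsStationary P) (hirr : IsIrreducible P r)
    (hf0 : Tendsto (fun n : ℕ => f n * Real.log (Real.log n) / n) atTop (𝓝 0)) :
    ∀ᵐ ω ∂P, ∀ᶠ n in atTop, r ≤ rhat n (block ω 0 n) := by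
  obtain ⟨_, q, hq⟩ := mem_markovLaws_iff.1 hord.1
  have hne : ∀ᵐ ω ∂P, ∀ k : Fin r, ∀ᶠ n in atTop, rhat n (block ω 0 n) ≠ k := by
    refine ae_all_iff.2 fun k => ?_
    obtain ⟨c, hc, hdecay⟩ := hq.ae_wordProb_le_exp hst hirr k.2.le
      fun hk => (hord.2 hk).not_gt k.2
    filter_upwards [hdecay, ae_wordProb_pos P] with ω ⟨D, hD⟩ hpos
    filter_upwards [hD, hpen, hκ, eventually_underestimation_gain_lt hf hf0
      (Nat.cast_pos.2 (Fintype.card_pos (α := A))) r k D hc] with n hDn hpn hκn hlt heq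
    have hle := hest.pen_le hord.1 hκn (hpos n) (B := D - c * n) (by rwa [heq])
    rw [heq, hpn, hpn] at hle
    exact hlt.not_ge hle
  filter_upwards [hne] with ω hω
  filter_upwards [eventually_all.2 hω] with n hn
  exact not_lt.1 fun hlt => hn ⟨_, hlt⟩ rfl

theorem ae_eventually_le_of_mem_markovLaws
    (hpen : ∀ᶠ n : ℕ in atTop, ∀ k : ℕ,
      pen n k = (Fintype.card A : ℝ) ^ k * f n * Real.log (Real.log n))
    (hκ : ∀ᶠ n in atTop, (r : ℝ) < κ n) (hf : ∀ᶠ n in atTop, 33 ≤ f n)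
    (hest : IsPenalizedLikelihoodEstimator pen κ rhat)
    (hP : P ∈ markovLaws A r) :
    ∀ᵐ ω ∂P, ∀ᶠ n in atTop, rhat n (block ω 0 n) ≤ r := by
  obtain ⟨_, q, hq⟩ := mem_markovLaws_iff.1 hP
  obtain ⟨δ, _, hover⟩ := hq.ae_exists_wordProb_le
  filter_upwards [hover, ae_wordProb_pos P] with ω ⟨D, hD, hle⟩ hpos
  filter_upwards [hpen, hκ, eventually_overestimation_cost_lt hf A r δ hD] with n hpn hκn hlt
  by_contra! hr
  have hpen_le := hest.pen_le hP hκn (hpos n) (hle n _ hr.le)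
  rw [hpn, hpn] at hpen_le
  exact (hlt _ hr).not_ge hpen_le

end Consistency

end MarkovOrder

end

theorem corollary1_general {A : Type*} [Fintype A] [Nontrivial A] [MeasurableSpace A]
    [MeasurableSingletonClass A] {P : Measure (ℕ → A)} {r : ℕ} (hord : MarkovOrder.HasOrder P r)
    (hst : MarkovOrder.IsStationary P) (hirr : MarkovOrder.IsIrreducible P r)
    {pen : ℕ → ℕ → ℝ} {κ f : ℕ → ℝ} {rhat : (n : ℕ) → (Fin n → A) → ℕ}
    (hpen : ∀ᶠ n : ℕ in atTop, ∀ k : ℕ,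
      pen n k = (Fintype.card A : ℝ) ^ k * f n * Real.log (Real.log n))
    (hκ : ∀ᶠ n in atTop, (r : ℝ) < κ n) (hf : ∀ᶠ n in atTop, 33 ≤ f n)
    (hf0 : Tendsto (fun n : ℕ => f n * Real.log (Real.log n) / n) atTop (𝓝 0))
    (hest : MarkovOrder.IsPenalizedLikelihoodEstimator pen κ rhat) :
    MarkovOrder.IsStronglyConsistent P r rhat := by
  filter_upwards [hord.ae_eventually_ge hpen hκ hf hest hst hirr hf0,
    MarkovOrder.ae_eventually_le_of_mem_markovLaws hpen hκ hf hest hord.1] with ω hge hle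
  refine tendsto_const_nhds.congr' ?_
  filter_upwards [hge, hle] with n using le_antisymm

theorem corollary1 :
    ∃ Cstar : ℝ, 0 < Cstar ∧
      ∀ (A : Type*) [Fintype A] [Nontrivial A] [MeasurableSpace A] [MeasurableSingletonClass A]
        (Pstar : Measure (ℕ → A)) (rstar : ℕ),
        MarkovOrder.HasOrder Pstar rstar →
        MarkovOrder.IsStationary Pstar →
        MarkovOrder.IsIrreducible Pstar rstar →
        ∃ αstar : ℝ, 0 < αstar ∧
          ∀ (pen : ℕ → ℕ → ℝ) (κ f : ℕ → ℝ) (rhat : (n : ℕ) → (Fin n → A) → ℕ),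
            (∀ᶠ n : ℕ in atTop, ∀ r : ℕ,
              pen n r = (Fintype.card A : ℝ) ^ r * f n * Real.log (Real.log n)) →
            (∀ᶠ n : ℕ in atTop, κ n ≤ αstar * Real.log n) →
            MonotoneOn κ (Set.Ici 1) →
            Tendsto κ atTop atTop →
            (Cstar : EReal) ≤ liminf (fun n : ℕ => (f n : EReal)) atTop →
            Tendsto (fun n : ℕ => f n * Real.log (Real.log n) / n) atTop (𝓝 0) →
            MarkovOrder.IsPenalizedLikelihoodEstimator pen κ rhat →
            MarkovOrder.IsStronglyConsistent Pstar rstar rhat := by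
  refine ⟨34, by norm_num, fun A _ _ _ _ P r hord hst hirr => ⟨1, one_pos, ?_⟩⟩
  intro pen κ f rhat hpen _ _ hκ hf hf0 hest
  have hlt : ((33 : ℝ) : EReal) < liminf (fun n : ℕ => (f n : EReal)) atTop :=
    (EReal.coe_lt_coe_iff.2 (by norm_num)).trans_le hf
  exact corollary1_general hord hst hirr hpen (hκ.eventually_gt_atTop _)
    ((eventually_lt_of_lt_liminf hlt).mono fun n hn => (EReal.coe_lt_coe_iff.1 hn).le) hf0 hest
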